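/- Let $(M^{4n},g,I,J)$ be a nondegenerate generalized Kähler manifold: $M$ is a smooth manifold of dimension $4n$, $I$ and $J$ are integrable complex structures on $M$, $g$ is a Riemannian metric compatible with both, $$d^c_I\omega_I = H = -d^c_J\omega_J,\qquad dH=0,$$ where $\omega_I=g(I\cdot,\cdot)$, $d^c_I\omega_I=-d\omega_I(I\cdot,I\cdot,I\cdot)$ (and likewise for $J$), and $\sigma=g^{-1}[I,J]$ is a nondegenerate pairing on every fibre of $T^*M$. Put $$F_\pm=-2\,g\big((I\pm J)^{-1}\cdot,\cdot\big),\quad \Omega=\sigma^{-1}=g\big([I,J]^{-1}\cdot,\cdot\big),\quad \varphi_+=e^{iF_+},\quad \varphi_-=e^{4\Omega+iF_-},$$ let $\langle\varphi,\psi\rangle=\sum_r(-1)^r\varphi_{2r}\wedge\psi_{4n-2r}$ for even complex forms, and let the Ricci potential be $$\Phi=\log\frac{\langle\varphi_+,\bar\varphi_+\rangle}{\langle\varphi_-,\bar\varphi_-\rangle},$$ which is a well-defined smooth real function (the denominator vanishes nowhere and the ratio is positive). Let $I$ and $J$ act on $1$-forms by $I\alpha=-\alpha\circ I$, $J\alpha=-\alpha\circ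 J$. Let $\nabla^{B,I}$ be the Bismut connection of $(g,I)$, $$\langle\nabla^{B,I}_XY,Z\rangle=\langle\nabla_XY,Z\rangle-\tfrac12 d^c_I\omega_I(X,Y,Z),$$ with $\nabla$ the Levi-Civita connection of $g$, and let $$(\rho_B)_I(X,Y)=\tfrac12\sum_i R^B(X,Y,e_i,Ie_i)$$ for a $g$-orthonormal basis $e_i$, where $R^B(X,Y,Z,W)=g(R_{X,Y}W,Z)$ and $R_{X,Y}=[\nabla^{B,I}_X,\nabla^{B,I}_Y]-\nabla^{B,I}_{[X,Y]}$ (so that $(\rho_B)_I$ is the usual Ricci form when $(g,I)$ is Kähler); define $(\rho_B)_J$ in the same way from $(g,J)$. Then $$(\rho_B)_I=-\tfrac12\,dJd\Phi,\qquad (\rho_B)_J=-\tfrac12\,dId\Phi .$$ In particular, if $M$ is compact and connected, then $(\rho_B)_I=0$ if and only if $(\rho_B)_J=0$, if and only if $\Phi$ is constant. -/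

import Mathlib

set_option maxSynthPendingDepth 3

open scoped Manifold ContDiff

noncomputable section

namespace GenKahler

/-! ### Pointwise algebra on a tangent space `V` -/

section Pointwise

variable {V : Type*} [AddCommGroup V] [Module ℝ V] [TopologicalSpace V]
  [IsTopologicalAddGroup V] [ContinuousSMul ℝ V]

/-- The commutator `[A, B] = A B - B A` of two endomorphisms. -/
def commutator (A B : V →L[ℝ] V) : V →L[ℝ] V := A ∘L B - B ∘L A

/-- The bivector `σ = g⁻¹ [I, J]`, as the map `T^*M → TM`, `α ↦ [I, J] (g⁻¹ α)`. -/
def poisson (g : V →L[ℝ] V →L[ℝ] ℝ) (I J : V →L[ℝ] V) (α : V →L[ℝ] ℝ) : V :=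
  commutator I J (ContinuousLinearMap.inverse g α)

/-- `F_± = -2 g (I ± J)⁻¹`, with `A` standing for `I ± J`. -/
def taming (g : V →L[ℝ] V →L[ℝ] ℝ) (A : V →L[ℝ] V) (v w : V) : ℝ :=
  -2 * g (ContinuousLinearMap.inverse A v) w

/-- `Ω = σ⁻¹`, that is `Ω(v, w) = g([I, J]⁻¹ v, w)`. -/
def symplecticForm (g : V →L[ℝ] V →L[ℝ] ℝ) (I J : V →L[ℝ] V) (v w : V) : ℝ :=
  g (ContinuousLinearMap.inverse (commutator I J) v) w

end Pointwise

/-! ### Spinors and the Mukai pairing -/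

section Spinors

variable {V : Type*} [AddCommGroup V] [Module ℝ V] [Module.Finite ℝ V]

/-- The algebra of complex-valued exterior forms on `V`. -/
abbrev ComplexForms (V : Type*) [AddCommGroup V] [Module ℝ V] : Type _ :=
  ExteriorAlgebra ℂ (V →ₗ[ℝ] ℂ)

/-- The real covector `ξ` as a complex exterior form of degree one. -/
def covector (ξ : V →ₗ[ℝ] ℝ) : ComplexForms V :=
  ExteriorAlgebra.ι ℂ ((Algebra.linearMap ℝ ℂ) ∘ₗ ξ)

/-- A complex-valued skew bilinear form `B` as the element `½ ∑ B(e_i, e_j) e^i ∧ e^j` of the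
exterior algebra (independent of the basis `e`). -/
def formElement (B : V → V → ℂ) : ComplexForms V :=
  let b := Module.finBasis ℝ V
  (1 / 2 : ℂ) • ∑ i, ∑ j, B (b i) (b j) • (covector (b.coord i) * covector (b.coord j))

/-- The spinor `e^B = 1 + B + B ∧ B / 2 + …`. -/
def spinor (B : V → V → ℂ) : ComplexForms V := IsNilpotent.exp (formElement B)

/-- The degree `k` component of an exterior form. -/
def degreePart (k : ℕ) (φ : ComplexForms V) : ComplexForms V :=
  GradedAlgebra.proj (fun i : ℕ ↦ ⋀[ℂ]^i (V →ₗ[ℝ] ℂ)) k φ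

/-- The pairing `⟨φ, ψ⟩ = ∑_r (-1)^r φ_{2r} ∧ ψ_{2m-2r}` on even forms, where `dim V = 2m`. -/
def mukai (φ ψ : ComplexForms V) : ComplexForms V :=
  let m := Module.finrank ℝ V / 2
  ∑ r ∈ Finset.range (m + 1),
    (-1 : ℂ) ^ r • (degreePart (2 * r) φ * degreePart (2 * m - 2 * r) ψ)

variable [TopologicalSpace V] [IsTopologicalAddGroup V] [ContinuousSMul ℝ V]

/-- `⟨φ_+, φ̄_+⟩` for the spinor `φ_+ = exp(i F_+)`, `F_+ = -2 g (I + J)⁻¹`. -/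
def pairingPlus (g : V →L[ℝ] V →L[ℝ] ℝ) (I J : V →L[ℝ] V) : ComplexForms V :=
  mukai (spinor fun v w ↦ Complex.I * (taming g (I + J) v w : ℂ))
    (spinor fun v w ↦ -Complex.I * (taming g (I + J) v w : ℂ))

/-- `⟨φ_-, φ̄_-⟩` for the spinor `φ_- = exp(4 Ω + i F_-)`, `F_- = -2 g (I - J)⁻¹`. -/
def pairingMinus (g : V →L[ℝ] V →L[ℝ] ℝ) (I J : V →L[ℝ] V) : ComplexForms V :=
  mukai
    (spinor fun v w ↦
      4 * (symplecticForm g I J v w : ℂ) + Complex.I * (taming g (I - J) v w : ℂ))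
    (spinor fun v w ↦
      4 * (symplecticForm g I J v w : ℂ) - Complex.I * (taming g (I - J) v w : ℂ))

/-- The ratio `a / b` of two elements of a line. -/
def formRatio (a b : ComplexForms V) : ℂ := Classical.epsilon fun c : ℂ ↦ a = c • b

end Spinors

/-! ### Tensor calculus on open subsets of the model space `E` -/

section Local

variable {E : Type*} [NormedAddCommGroup E] [NormedSpace ℝ E]

/-- The 2-form given by a skew bilinear form (in general, the skew part of the bilinear form). -/
def twoForm (B : E →L[ℝ] E →L[ℝ] ℝ) : E [⋀^Fin 2]→L[ℝ] ℝ :=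
  (1 / 2 : ℝ) • ContinuousAlternatingMap.alternatizeUncurryFin
    ((ContinuousAlternatingMap.ofSubsingletonLIE (𝕜 := ℝ) (E := E) (F := ℝ)
      (0 : Fin 1)).toContinuousLinearEquiv.toContinuousLinearMap ∘L B)

theorem twoForm_apply (B : E →L[ℝ] E →L[ℝ] ℝ) (v w : E) :
    twoForm B ![v, w] = (1 / 2) * (B v w - B w v) := by
  simp [twoForm, ContinuousAlternatingMap.alternatizeUncurryFin_apply, Fin.sum_univ_two,
    Fin.removeNth, sub_eq_add_neg]

/-- A 3-form as a trilinear map. -/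
def trilinear (H : E [⋀^Fin 3]→L[ℝ] ℝ) : E →L[ℝ] E →L[ℝ] E →L[ℝ] ℝ :=
  ((ContinuousLinearMap.compL ℝ E (E [⋀^Fin 1]→L[ℝ] ℝ) (E →L[ℝ] ℝ)
      ((ContinuousAlternatingMap.ofSubsingletonLIE (0 : Fin 1)).symm.toContinuousLinearEquiv.toContinuousLinearMap)) ∘L
    ContinuousAlternatingMap.curryLeftLI.toContinuousLinearMap) ∘L H.curryLeft

theorem trilinear_apply (H : E [⋀^Fin 3]→L[ℝ] ℝ) (v w u : E) :
    trilinear H v w u = H ![v, w, u] := by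
  have h : (H.curryLeft v).curryLeft w ![u] = H ![v, w, u] := rfl
  rw [← h]
  have h2 : ∀ f : E [⋀^Fin 1]→L[ℝ] ℝ,
      (ContinuousAlternatingMap.ofSubsingletonLIE (0 : Fin 1)).symm f u = f ![u] := by
    intro f
    obtain ⟨a, rfl⟩ := (ContinuousAlternatingMap.ofSubsingletonLIE (𝕜 := ℝ) (E := E) (F := ℝ)
      (0 : Fin 1)).surjective f
    rw [LinearIsometryEquiv.symm_apply_apply]
    rfl
  exact h2 _

/-- The fundamental 2-form `ω = g I`, that is `ω(v, w) = g(I v, w)`. -/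
def fundamentalForm (g : E → E →L[ℝ] E →L[ℝ] ℝ) (I : E → E →L[ℝ] E) (y : E) :
    E [⋀^Fin 2]→L[ℝ] ℝ :=
  twoForm (g y ∘L I y)

/-- `d^c ω (u, v, w) = - dω(I u, I v, I w)`. -/
def dcOmega (g : E → E →L[ℝ] E →L[ℝ] ℝ) (I : E → E →L[ℝ] E) (y : E) :
    E [⋀^Fin 3]→L[ℝ] ℝ :=
  -(extDeriv (fundamentalForm g I) y).compContinuousLinearMap (I y)

/-- The Nijenhuis tensor `[Iv, Iw] - I [Iv, w] - I [v, Iw] - [v, w]`, on the constant vector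
fields with values `v` and `w`. -/
def nijenhuis (I : E → E →L[ℝ] E) (y v w : E) : E :=
  VectorField.lieBracket ℝ (fun z ↦ I z v) (fun z ↦ I z w) y
    - I y (VectorField.lieBracket ℝ (fun z ↦ I z v) (fun _ ↦ w) y)
    - I y (VectorField.lieBracket ℝ (fun _ ↦ v) (fun z ↦ I z w) y)
    - VectorField.lieBracket ℝ (fun _ ↦ v) (fun _ ↦ w) y

/-- The action `I α = - α ∘ I` of a complex structure on a covector. -/
def rotate (I : E →L[ℝ] E) (α : E →L[ℝ] ℝ) : E →L[ℝ] ℝ := -(α ∘L I)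

/-- The 2-form `d I d f`. -/
def dId (I : E → E →L[ℝ] E) (f : E → ℝ) (y : E) : E [⋀^Fin 2]→L[ℝ] ℝ :=
  extDeriv (fun z ↦ ContinuousAlternatingMap.ofSubsingletonLIE (0 : Fin 1)
    (rotate (I z) (fderiv ℝ f z))) y

/-- `⟨∇_v w, u⟩` for the Levi-Civita connection of `g` and constant vector fields `v, w, u`
(Koszul formula): `½ (v g(w, u) + w g(v, u) - u g(v, w))`. -/
def christoffel (g : E → E →L[ℝ] E →L[ℝ] ℝ) (y : E) : E →L[ℝ] E →L[ℝ] E →L[ℝ] ℝ :=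
  let D := fderiv ℝ g y
  (1 / 2 : ℝ) • (D + D.flip
    - (ContinuousLinearMap.flipₗᵢ ℝ E E ℝ).toContinuousLinearEquiv.toContinuousLinearMap ∘L D.flip)

theorem christoffel_apply (g : E → E →L[ℝ] E →L[ℝ] ℝ) (y v w u : E) :
    christoffel g y v w u = (1 / 2) * (fderiv ℝ g y v w u + fderiv ℝ g y w v u
      - fderiv ℝ g y u v w) := by
  simp [christoffel]

/-- The connection form `A` of the Bismut connection of `(g, I)` in a chart, so that
`∇^B_X Y = DY(X) + A(X) Y` for vector fields `X, Y`. It is determined by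
`⟨∇^B_v w, u⟩ = ⟨∇_v w, u⟩ - ½ d^c ω (v, w, u)` for constant vector fields `v, w, u`. -/
def bismutForm (g : E → E →L[ℝ] E →L[ℝ] ℝ) (I : E → E →L[ℝ] E) (y : E) :
    E →L[ℝ] E →L[ℝ] E :=
  (ContinuousLinearMap.compL ℝ E (E →L[ℝ] ℝ) E (ContinuousLinearMap.inverse (g y))) ∘L
    (christoffel g y - (1 / 2 : ℝ) • trilinear (dcOmega g I y))

theorem bismutForm_inner (g : E → E →L[ℝ] E →L[ℝ] ℝ) (I : E → E →L[ℝ] E) (y v w u : E)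
    (hg : (g y).IsInvertible) :
    g y (bismutForm g I y v w) u
      = christoffel g y v w u - (1 / 2) * dcOmega g I y ![v, w, u] := by
  simp [bismutForm, hg.self_apply_inverse, trilinear_apply]

/-- The curvature `R(v, w) = [∇_v, ∇_w] - ∇_[v, w]` of the connection `∇ = D + A`, an endomorphism
of the tangent space. -/
def curvature (A : E → E →L[ℝ] E →L[ℝ] E) (y v w : E) : E →L[ℝ] E :=
  fderiv ℝ A y v w - fderiv ℝ A y w v + (A y v ∘L A y w - A y w ∘L A y v)

/-- The Bismut-Ricci form `ρ_B(v, w) = ½ ∑ R(v, w, e_i, I e_i)`, where `e_i` is an orthonormal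
basis, `R(v, w, a, b) = g(R(v, w) b, a)` is the curvature tensor of the Bismut connection
and the sum is written as the trace of `R(v, w) ∘ I`; see `bismutRicci_eq_sum`.
In this sign convention `ρ_B` is the usual Ricci form if the metric is Kähler. -/
def bismutRicci (g : E → E →L[ℝ] E →L[ℝ] ℝ) (I : E → E →L[ℝ] E) (y v w : E) : ℝ :=
  (1 / 2) * LinearMap.trace ℝ E (curvature (bismutForm g I) y v w ∘L I y).toLinearMap

theorem bismutRicci_eq_sum {ι : Type*} [Fintype ι] [DecidableEq ι]
    (g : E → E →L[ℝ] E →L[ℝ] ℝ) (I : E → E →L[ℝ] E) (y v w : E)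
    (e : Module.Basis ι ℝ E) (he : ∀ i j, g y (e i) (e j) = if i = j then 1 else 0) :
    bismutRicci g I y v w
      = (1 / 2) * ∑ i, g y (curvature (bismutForm g I) y v w (I y (e i))) (e i) := by
  rw [bismutRicci, LinearMap.trace_eq_matrix_trace ℝ e, Matrix.trace]
  congr 1
  refine Finset.sum_congr rfl fun i _ ↦ ?_
  rw [Matrix.diag_apply, LinearMap.toMatrix_apply]
  have key : ∀ x : E, e.repr x i = g y x (e i) := by
    intro x
    conv_rhs => rw [← e.sum_repr x]
    simp only [map_sum, map_smul, sum_apply, smul_apply,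
      he, smul_eq_mul, mul_ite, mul_one, mul_zero, Finset.sum_ite_eq', Finset.mem_univ, if_true]
  rw [key]
  rfl

end Local

/-! ### Generalized Kähler manifolds -/

section Manifold

variable {E : Type*} [NormedAddCommGroup E] [NormedSpace ℝ E] [FiniteDimensional ℝ E]
  {M : Type*} [TopologicalSpace M] [ChartedSpace E M] [IsManifold 𝓘(ℝ, E) ∞ M]

variable (E M) in
/-- Smooth Riemannian metrics on `M`. -/
abbrev Metric : Type _ :=
  Bundle.ContMDiffRiemannianMetric 𝓘(ℝ, E) ∞ E (fun x : M ↦ TangentSpace 𝓘(ℝ, E) x)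

variable (E M) in
/-- Fields of endomorphisms of the tangent spaces of `M`. -/
abbrev EndField : Type _ := ∀ x : M, TangentSpace 𝓘(ℝ, E) x →L[ℝ] TangentSpace 𝓘(ℝ, E) x

/-- The metric `g` in the chart `e`, at the point `y` of the model space. -/
def metricIn (g : Metric E M) (e : OpenPartialHomeomorph M E) (y : E) : E →L[ℝ] E →L[ℝ] ℝ :=
  let D : E →L[ℝ] E := mfderiv 𝓘(ℝ, E) 𝓘(ℝ, E) e.symm y
  let G : E →L[ℝ] E →L[ℝ] ℝ := g.inner (e.symm y)
  G.bilinearComp D D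

/-- The endomorphism field `A` in the chart `e`, at the point `y` of the model space. -/
def endIn (A : EndField E M) (e : OpenPartialHomeomorph M E) (y : E) : E →L[ℝ] E :=
  (mfderiv 𝓘(ℝ, E) 𝓘(ℝ, E) e (e.symm y)) ∘L A (e.symm y) ∘L
    (mfderiv 𝓘(ℝ, E) 𝓘(ℝ, E) e.symm y)

/-- `I` is a smooth integrable almost complex structure, orthogonal for `g`. -/
structure IsHermitian (g : Metric E M) (I : EndField E M) : Prop where
  smooth : ContMDiff 𝓘(ℝ, E) (𝓘(ℝ, E).prod 𝓘(ℝ, E →L[ℝ] E)) ∞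
    (fun x ↦ Bundle.TotalSpace.mk' (E →L[ℝ] E)
      (E := fun x : M ↦ TangentSpace 𝓘(ℝ, E) x →L[ℝ] TangentSpace 𝓘(ℝ, E) x) x (I x))
  sq : ∀ (x : M) (v : TangentSpace 𝓘(ℝ, E) x), I x (I x v) = -v
  integrable : ∀ e ∈ atlas E M, ∀ y ∈ e.target, ∀ v w : E, nijenhuis (endIn I e) y v w = 0
  compatible : ∀ (x : M) (v w : TangentSpace 𝓘(ℝ, E) x),
    g.inner x (I x v) (I x w) = g.inner x v w

/-- `(g, I, J)` is a generalized Kähler structure: `I`, `J` are integrable complex structures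
compatible with `g`, and `d^c_I ω_I = H = - d^c_J ω_J` with `dH = 0`. -/
structure IsGeneralizedKahler (g : Metric E M) (I J : EndField E M) : Prop where
  hermitian_left : IsHermitian g I
  hermitian_right : IsHermitian g J
  torsion : ∀ e ∈ atlas E M, ∀ y ∈ e.target,
    dcOmega (metricIn g e) (endIn I e) y = -dcOmega (metricIn g e) (endIn J e) y
  closed : ∀ e ∈ atlas E M, ∀ y ∈ e.target,
    extDeriv (dcOmega (metricIn g e) (endIn I e)) y = 0

/-- `σ = g⁻¹ [I, J]` is a nondegenerate pairing on every cotangent space. -/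
def IsNondegenerate (g : Metric E M) (I J : EndField E M) : Prop :=
  ∀ (x : M) (α : TangentSpace 𝓘(ℝ, E) x →L[ℝ] ℝ),
    (∀ β : TangentSpace 𝓘(ℝ, E) x →L[ℝ] ℝ, β (poisson (g.inner x) (I x) (J x) α) = 0) → α = 0

instance (x : M) : Module.Finite ℝ (TangentSpace 𝓘(ℝ, E) x) :=
  inferInstanceAs (Module.Finite ℝ E)

/-- `⟨φ_+, φ̄_+⟩` at the point `x`. -/
def pairingPlusAt (g : Metric E M) (I J : EndField E M) (x : M) :
    ComplexForms (TangentSpace 𝓘(ℝ, E) x) :=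
  pairingPlus (g.inner x) (I x) (J x)

/-- `⟨φ_-, φ̄_-⟩` at the point `x`. -/
def pairingMinusAt (g : Metric E M) (I J : EndField E M) (x : M) :
    ComplexForms (TangentSpace 𝓘(ℝ, E) x) :=
  pairingMinus (g.inner x) (I x) (J x)

/-- The Ricci potential `Φ = log (⟨φ_+, φ̄_+⟩ / ⟨φ_-, φ̄_-⟩)`. -/
def ricciPotential (g : Metric E M) (I J : EndField E M) (x : M) : ℝ :=
  Real.log (formRatio (pairingPlusAt g I J x) (pairingMinusAt g I J x)).re

/-- The identity `(ρ_B)_I = -½ d J d f` of 2-forms on `M`, for the Bismut-Ricci form of `(g, I)`,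
a second complex structure `J` and a function `f`. -/
def RicciIdentity (g : Metric E M) (I J : EndField E M) (f : M → ℝ) : Prop :=
  ∀ e ∈ atlas E M, ∀ y ∈ e.target, ∀ v w : E,
    bismutRicci (metricIn g e) (endIn I e) y v w
      = -(1 / 2) * dId (endIn J e) (f ∘ e.symm) y ![v, w]

/-- The Bismut-Ricci form of `(g, I)` vanishes on `M`. -/
def BismutRicciFlat (g : Metric E M) (I : EndField E M) : Prop :=
  ∀ e ∈ atlas E M, ∀ y ∈ e.target, ∀ v w : E,
    bismutRicci (metricIn g e) (endIn I e) y v w = 0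

end Manifold

end GenKahler

end

/-!
The argument takes place in charts and has three parts.

*The potential.* The spinors `φ_±` are exponentials, so that `⟨φ_±, φ̄_±⟩` depends on the difference
of the exponents only and is the top power of `-2 i F_±` divided by a factorial (`mukai_spinor`).
With `S = [I, J]⁻¹` one has `(I + J)⁻¹ = S (I - J)` and `(I - J)⁻¹ = S (-I - J)`, and the path
`S (s I - J)`, `-1 ≤ s ≤ 1`, of invertible endomorphisms, skew for `g`, joins the two. Along it the
Pfaffian and the square root of the determinant satisfy the same linear differential equation
(`realForm_path_pow`). Hence the ratio of the pairings is the square root of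
`det (I - J) / det (I + J)`, and the Ricci potential is
`Φ = ½ log (det (I - J) / det (I + J))` (`ricciPotential_eq`).

*The curvature.* The Bismut connections of `I` and `J` preserve `I` and `J`, respectively
(`fderiv_eq_commutator`); by `d^c_I ω_I = -d^c_J ω_J` their connection forms `Γ_I` and `Γ_J` differ
by the torsion 3-form. Differentiating the determinants therefore gives
`dΦ = -2 tr (S (Γ_J - Γ_I))` (`fderiv_logDetRatio`). Since the torsion has type `(2, 1) + (1, 2)`
for `J` and `S` anticommutes with `I` and `J`, the rotated differential `J dΦ` can be expressed by
`tr (I Γ_I)` and the derivative of `[I, J]` (`two_mul_rotate_fderiv`), and the exterior derivative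
of this expression is the trace of the curvature (`bismutRicci_eq`). The second identity follows by
exchanging `I` and `J`, which does not change `Φ`.

*The compact case.* If `d J d u = 0`, its value on `v, J v` says that
`D²u(v, v) + D²u(J v, J v)` equals a first order term in `u`. Taking for `v` the normal vector of a
touching ball, the barrier of E. Hopf shows that the set where `u` takes its maximum is open
(`eventually_eq_of_isLocalMax`), so `u` is constant on a compact connected manifold.
-/

open scoped Manifold ContDiff

noncomputable section

namespace GenKahler

/-! ### The Mukai pairing of exponential spinors -/

section ExteriorForms

variable {V : Type*} [AddCommGroup V] [Module ℝ V]

theorem covector_mem (ξ : V →ₗ[ℝ] ℝ) :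
    (covector ξ : ComplexForms V) ∈ ⋀[ℂ]^1 (V →ₗ[ℝ] ℂ) := by
  have h := LinearMap.mem_range_self (ExteriorAlgebra.ι ℂ) ((Algebra.linearMap ℝ ℂ) ∘ₗ ξ)
  simpa only [pow_one, covector] using h

theorem covector_add (ξ η : V →ₗ[ℝ] ℝ) :
    (covector (ξ + η) : ComplexForms V) = covector ξ + covector η := by
  simp [covector, LinearMap.comp_add]

theorem covector_smul (c : ℝ) (ξ : V →ₗ[ℝ] ℝ) :
    (covector (c • ξ) : ComplexForms V) = (c : ℂ) • covector ξ := by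
  rw [covector, covector, ← map_smul]
  congr 1
  ext v
  simp

theorem covector_mul_swap (ξ η : V →ₗ[ℝ] ℝ) :
    (covector ξ * covector η : ComplexForms V) = -(covector η * covector ξ) :=
  eq_neg_of_add_eq_zero_left (ExteriorAlgebra.ι_add_mul_swap _ _)

variable [Module.Finite ℝ V]

theorem formElement_mem (B : V → V → ℂ) :
    formElement B ∈ ⋀[ℂ]^2 (V →ₗ[ℝ] ℂ) := by
  refine Submodule.smul_mem _ _ (Submodule.sum_mem _ fun i _ ↦ Submodule.sum_mem _ fun j _ ↦
    Submodule.smul_mem _ _ ?_)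
  exact SetLike.mul_mem_graded (A := fun i : ℕ ↦ ⋀[ℂ]^i (V →ₗ[ℝ] ℂ))
    (covector_mem _) (covector_mem _)

theorem formElement_pow_mem (B : V → V → ℂ) (k : ℕ) :
    formElement B ^ k ∈ ⋀[ℂ]^(2 * k) (V →ₗ[ℝ] ℂ) := by
  have h := SetLike.pow_mem_graded (A := fun i : ℕ ↦ ⋀[ℂ]^i (V →ₗ[ℝ] ℂ)) k (formElement_mem B)
  rwa [smul_eq_mul, mul_comm] at h

theorem eq_zero_of_mem_of_finrank_lt {k : ℕ} (hk : Module.finrank ℝ V < k) {x : ComplexForms V}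
    (hx : x ∈ ⋀[ℂ]^k (V →ₗ[ℝ] ℂ)) : x = 0 := by
  have h : Module.finrank ℂ (⋀[ℂ]^k (V →ₗ[ℝ] ℂ)) = 0 := by
    rw [exteriorPower.finrank_eq, Module.finrank_linearMap, Module.finrank_self, mul_one,
      Nat.choose_eq_zero_of_lt hk]
  have h' := Submodule.finrank_eq_zero.mp h
  rw [h'] at hx
  exact hx

theorem formElement_pow_eq_zero (B : V → V → ℂ) {k : ℕ} (hk : Module.finrank ℝ V < 2 * k) :
    formElement B ^ k = 0 :=
  eq_zero_of_mem_of_finrank_lt hk (formElement_pow_mem B k)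

/-- Forms of degree two are central in the exterior algebra. -/
theorem commute_formElement_covector (B : V → V → ℂ) (ξ : V →ₗ[ℝ] ℝ) :
    Commute (formElement B) (covector ξ) := by
  refine Commute.smul_left (Commute.sum_left _ _ _ fun i _ ↦ Commute.sum_left _ _ _ fun j _ ↦
    Commute.smul_left ?_ _) _
  rw [Commute, SemiconjBy, mul_assoc, covector_mul_swap _ ξ, mul_neg, ← mul_assoc,
    covector_mul_swap _ ξ, neg_mul, neg_neg, mul_assoc]

theorem commute_formElement (B C : V → V → ℂ) : Commute (formElement B) (formElement C) := by
  refine Commute.smul_right (Commute.sum_right _ _ _ fun i _ ↦ Commute.sum_right _ _ _ fun j _ ↦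
    Commute.smul_right ?_ _) _
  exact (commute_formElement_covector B _).mul_right (commute_formElement_covector B _)

theorem formElement_sub (B C : V → V → ℂ) :
    formElement B - formElement C = formElement fun v w ↦ B v w - C v w := by
  simp only [formElement, ← smul_sub, ← Finset.sum_sub_distrib, ← sub_smul]

theorem formElement_smul (c : ℂ) (B : V → V → ℂ) :
    (formElement fun v w ↦ c * B v w) = c • formElement B := by
  simp only [formElement, mul_smul, ← Finset.smul_sum]
  rw [smul_comm]

theorem degreePart_spinor (B : V → V → ℂ) (r : ℕ) :
    degreePart (2 * r) (spinor B) = ((r.factorial : ℂ))⁻¹ • formElement B ^ r := by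
  set N := max (r + 1) (Module.finrank ℝ V + 1)
  have hN : formElement B ^ N = 0 := formElement_pow_eq_zero B (by omega)
  rw [spinor, IsNilpotent.exp_eq_sum hN, degreePart, map_sum]
  have key : ∀ i, GradedAlgebra.proj (fun i : ℕ ↦ ⋀[ℂ]^i (V →ₗ[ℝ] ℂ)) (2 * r)
      ((i.factorial : ℚ)⁻¹ • formElement B ^ i)
      = if i = r then ((r.factorial : ℂ))⁻¹ • formElement B ^ r else 0 := by
    intro i
    have hc : ((i.factorial : ℚ)⁻¹ • formElement B ^ i)
        = ((i.factorial : ℂ)⁻¹ • formElement B ^ i) := by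
      rw [← Rat.cast_smul_eq_qsmul ℂ]; simp
    rw [hc, map_smul, GradedAlgebra.proj_apply]
    split_ifs with h
    · subst h
      rw [DirectSum.decompose_of_mem_same (fun i : ℕ ↦ ⋀[ℂ]^i (V →ₗ[ℝ] ℂ))
        (formElement_pow_mem B i)]
    · rw [DirectSum.decompose_of_mem_ne (fun i : ℕ ↦ ⋀[ℂ]^i (V →ₗ[ℝ] ℂ))
        (formElement_pow_mem B i) (by omega), smul_zero]
  simp only [key]
  rw [Finset.sum_ite_eq' , if_pos]
  simp [N]

/-- On exponential spinors only the difference of the exponents matters. -/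
theorem mukai_spinor {m : ℕ} (hm : Module.finrank ℝ V = 2 * m) (B C : V → V → ℂ) :
    mukai (spinor B) (spinor C)
      = ((m.factorial : ℂ))⁻¹ • (formElement fun v w ↦ C v w - B v w) ^ m := by
  have hm' : Module.finrank ℝ V / 2 = m := by omega
  rw [mukai]
  simp only [hm']
  rw [← formElement_sub, sub_eq_neg_add,
    (commute_formElement B C).neg_left.add_pow, Finset.smul_sum]
  refine Finset.sum_congr rfl fun r hr ↦ ?_
  have hr' : r ≤ m := by simpa [Nat.lt_succ_iff] using hr
  rw [← Nat.mul_sub, degreePart_spinor, degreePart_spinor, smul_mul_smul_comm,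
    neg_pow (formElement B), ← Nat.cast_comm, ← nsmul_eq_mul, ← Nat.cast_smul_eq_nsmul ℂ,
    smul_smul, smul_smul,
    show ((-1 : ComplexForms V) ^ r) = ((-1 : ℂ) ^ r) • (1 : ComplexForms V) by
      simp [Algebra.smul_def],
    smul_mul_assoc, smul_mul_assoc, one_mul, smul_smul]
  congr 1
  rw [Nat.cast_choose ℂ hr']
  have h1 := Nat.cast_ne_zero (R := ℂ).mpr (Nat.factorial_ne_zero m)
  have h2 := Nat.cast_ne_zero (R := ℂ).mpr (Nat.factorial_ne_zero r)
  have h3 := Nat.cast_ne_zero (R := ℂ).mpr (Nat.factorial_ne_zero (m - r))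
  field_simp

end ExteriorForms

/-! ### Top powers of 2-forms -/

section Contraction

variable {V : Type*} [AddCommGroup V] [Module ℝ V]

/-- Contraction of complex exterior forms with the real vector `v`. -/
def contract (v : V) : ComplexForms V →ₗ[ℂ] ComplexForms V :=
  CliffordAlgebra.contractLeft (Q := 0)
    { toFun := fun ξ : V →ₗ[ℝ] ℂ ↦ ξ v, map_add' := fun _ _ ↦ rfl, map_smul' := fun _ _ ↦ rfl }

theorem contract_covector_mul (v : V) (ξ : V →ₗ[ℝ] ℝ) (x : ComplexForms V) :
    contract v (covector ξ * x) = (ξ v : ℂ) • x - covector ξ * contract v x :=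
  CliffordAlgebra.contractLeft_ι_mul _ _ _

theorem contract_one (v : V) : contract v (1 : ComplexForms V) = 0 :=
  CliffordAlgebra.contractLeft_one (Q := (0 : QuadraticForm ℂ (V →ₗ[ℝ] ℂ))) _

theorem contract_covector (v : V) (ξ : V →ₗ[ℝ] ℝ) :
    contract v (covector ξ) = (ξ v : ℂ) • (1 : ComplexForms V) := by
  simpa [contract_one] using contract_covector_mul v ξ 1

theorem contract_covector_mul_covector (v : V) (ξ η : V →ₗ[ℝ] ℝ) :
    contract v (covector ξ * covector η : ComplexForms V)
      = (ξ v : ℂ) • covector η - (η v : ℂ) • covector ξ := by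
  rw [contract_covector_mul, contract_covector, mul_smul_comm, mul_one]

theorem covector_sum {ι : Type*} (s : Finset ι) (c : ι → ℝ) (ξ : ι → V →ₗ[ℝ] ℝ) :
    (covector (∑ i ∈ s, c i • ξ i) : ComplexForms V) = ∑ i ∈ s, (c i : ℂ) • covector (ξ i) := by
  classical
  induction s using Finset.induction_on with
  | empty => simp [covector]
  | insert a s ha ih => rw [Finset.sum_insert ha, Finset.sum_insert ha, covector_add, ih,
      covector_smul]

variable [Module.Finite ℝ V]

/-- The exterior form of degree two of a real bilinear form. -/
abbrev realForm (β : V →ₗ[ℝ] V →ₗ[ℝ] ℝ) : ComplexForms V := formElement fun v w ↦ (β v w : ℂ)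

theorem realForm_eq_sum (β : V →ₗ[ℝ] V →ₗ[ℝ] ℝ) :
    realForm β = (1 / 2 : ℂ) • ∑ i, covector ((Module.finBasis ℝ V).coord i)
      * covector (β (Module.finBasis ℝ V i)) := by
  rw [realForm, formElement]
  congr 1
  refine Finset.sum_congr rfl fun i _ ↦ ?_
  have h : β (Module.finBasis ℝ V i)
      = ∑ j, β (Module.finBasis ℝ V i) (Module.finBasis ℝ V j) • (Module.finBasis ℝ V).coord j := by
    refine (Module.finBasis ℝ V).ext fun k ↦ ?_
    simp
  conv_rhs => rw [h, covector_sum, Finset.mul_sum]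
  simp only [mul_smul_comm]

theorem contract_realForm {β : V →ₗ[ℝ] V →ₗ[ℝ] ℝ} (hβ : ∀ v w, β v w = -β w v) (v : V) :
    contract v (realForm β) = covector (β v) := by
  rw [realForm_eq_sum, map_smul, map_sum]
  simp only [contract_covector_mul_covector, Finset.sum_sub_distrib]
  have h1 : ∑ i, (((Module.finBasis ℝ V).coord i v : ℝ) : ℂ)
      • (covector (β (Module.finBasis ℝ V i)) : ComplexForms V) = covector (β v) := by
    rw [← covector_sum]
    congr 1
    conv_rhs => rw [← (Module.finBasis ℝ V).sum_repr v, map_sum]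
    simp
  have h2 : ∑ i, ((β (Module.finBasis ℝ V i) v : ℝ) : ℂ)
      • (covector ((Module.finBasis ℝ V).coord i) : ComplexForms V) = -covector (β v) := by
    rw [← covector_sum, ← neg_one_smul ℂ, ← Complex.ofReal_one, ← Complex.ofReal_neg,
      ← covector_smul]
    congr 1
    refine (Module.finBasis ℝ V).ext fun k ↦ ?_
    simp [Finsupp.single_apply, hβ v]
  rw [h1, h2, sub_neg_eq_add, ← two_smul ℂ, smul_smul]
  norm_num

/-- Contraction is a derivation on products with a form of degree two. -/
theorem contract_realForm_mul {β : V →ₗ[ℝ] V →ₗ[ℝ] ℝ} (hβ : ∀ v w, β v w = -β w v) (v : V)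
    (x : ComplexForms V) :
    contract v (realForm β * x) = covector (β v) * x + realForm β * contract v x := by
  rw [← contract_realForm hβ, realForm_eq_sum]
  simp only [map_smul, map_sum, smul_mul_assoc, ← smul_add, Finset.sum_mul,
    ← Finset.sum_add_distrib, mul_assoc, contract_covector_mul, contract_covector, mul_sub, sub_mul,
    mul_smul_comm, mul_one]
  congr 1
  refine Finset.sum_congr rfl fun i _ ↦ ?_
  abel

theorem contract_realForm_pow {β : V →ₗ[ℝ] V →ₗ[ℝ] ℝ} (hβ : ∀ v w, β v w = -β w v) (v : V)
    (k : ℕ) :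
    contract v (realForm β ^ (k + 1)) = ((k : ℂ) + 1) • (covector (β v) * realForm β ^ k) := by
  induction k with
  | zero => simp [contract_realForm hβ]
  | succ k ih =>
    rw [pow_succ', contract_realForm_mul hβ, ih, mul_smul_comm, ← mul_assoc,
      (commute_formElement_covector _ _).eq, mul_assoc, ← pow_succ',
      Nat.cast_succ]
    module

/-- The derivative of the Pfaffian: the top power of a skew form `β` is a density, so it scales
by half the trace when `β` is varied by `β (X ·, ·)`. -/
theorem smul_realForm_mul_pow {m : ℕ} (hm : Module.finrank ℝ V = 2 * m)
    {β γ : V →ₗ[ℝ] V →ₗ[ℝ] ℝ} (hβ : ∀ v w, β v w = -β w v)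
    (X : V →ₗ[ℝ] V) (hX : ∀ v w, γ v w = β (X v) w) :
    (m : ℂ) • (realForm γ * realForm β ^ (m - 1))
      = ((1 / 2 * LinearMap.trace ℝ V X : ℝ) : ℂ) • realForm β ^ m := by
  have htr : LinearMap.trace ℝ V X
      = ∑ i, (Module.finBasis ℝ V).coord i (X (Module.finBasis ℝ V i)) := by
    rw [LinearMap.trace_eq_matrix_trace ℝ (Module.finBasis ℝ V), Matrix.trace]
    refine Finset.sum_congr rfl fun i _ ↦ ?_
    rw [Matrix.diag_apply, LinearMap.toMatrix_apply]
    rfl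
  have hγ : ∀ i, γ (Module.finBasis ℝ V i) = β (X (Module.finBasis ℝ V i)) := fun i ↦
    LinearMap.ext fun w ↦ hX _ _
  -- A form of top degree is killed by every covector, so contracting and wedging gives it back.
  have htop : ∀ (ξ : V →ₗ[ℝ] ℝ) (v : V), covector ξ * contract v (realForm β ^ m)
      = (ξ v : ℂ) • realForm β ^ m := by
    intro ξ v
    have h0 : covector ξ * realForm β ^ m = 0 := by
      refine eq_zero_of_mem_of_finrank_lt (k := 1 + 2 * m) (by omega) ?_
      exact SetLike.mul_mem_graded (A := fun i : ℕ ↦ ⋀[ℂ]^i (V →ₗ[ℝ] ℂ)) (covector_mem ξ)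
        (formElement_pow_mem _ m)
    have h1 := contract_covector_mul v ξ (realForm β ^ m)
    rw [h0, map_zero] at h1
    exact (sub_eq_zero.mp h1.symm).symm
  rcases m with _ | k
  · have : Subsingleton V := Module.finrank_zero_iff.mp hm
    have : X = 0 := Subsingleton.elim _ _
    simp [this]
  rw [realForm_eq_sum γ, htr, smul_mul_assoc, Finset.sum_mul, smul_comm, Finset.smul_sum,
    Complex.ofReal_mul, Complex.ofReal_sum, mul_smul, Finset.sum_smul]
  congr 1
  · norm_num
  refine Finset.sum_congr rfl fun i _ ↦ ?_
  rw [← htop, contract_realForm_pow hβ, hγ, Nat.add_sub_cancel, mul_assoc, mul_smul_comm,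
    Nat.cast_succ]

/-- The top power of a nondegenerate skew form does not vanish. -/
theorem realForm_pow_ne_zero {m : ℕ} (hm : Module.finrank ℝ V = 2 * m)
    {β : V →ₗ[ℝ] V →ₗ[ℝ] ℝ} (hβ : ∀ v w, β v w = -β w v) (hnd : Function.Surjective β) :
    realForm β ^ m ≠ 0 := by
  intro h0
  -- If every product of `k + 1` covectors kills `y`, so does a product one factor of which has been
  -- removed by a contraction and replaced by another covector.
  have aux : ∀ (y : ComplexForms V) (v : V) (k : ℕ),
      (∀ l : List (V →ₗ[ℝ] ℝ), l.length = k → (l.map covector).prod * y = 0) →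
      ∀ l p : List (V →ₗ[ℝ] ℝ), p.length + l.length = k + 1 →
        (p.map covector).prod * contract v (l.map covector).prod * y = 0 := by
    intro y v k hk l
    induction l with
    | nil => intro p _; simp [contract_one]
    | cons a l ih =>
      intro p hp
      rw [List.map_cons, List.prod_cons, contract_covector_mul, mul_sub, sub_mul, mul_smul_comm,
        smul_mul_assoc, ← List.prod_append, ← List.map_append, hk _ (by simp at hp ⊢; omega),
        smul_zero, zero_sub, neg_eq_zero]
      have := ih (p ++ [a]) (by simp at hp ⊢; omega)
      simpa [mul_assoc] using this
  -- Contraction is an antiderivation.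
  have hsign : ∀ (v : V) (l : List (V →ₗ[ℝ] ℝ)) (y : ComplexForms V),
      contract v ((l.map covector).prod * y) = contract v (l.map covector).prod * y
        + (-1 : ℂ) ^ l.length • ((l.map covector).prod * contract v y) := by
    intro v l y
    induction l with
    | nil => simp [contract_one]
    | cons a l ih =>
      rw [List.map_cons, List.prod_cons, mul_assoc, contract_covector_mul, ih,
        contract_covector_mul, List.length_cons, pow_succ, mul_neg_one, neg_smul, mul_add, sub_mul,
        smul_mul_assoc, mul_assoc, mul_assoc, mul_smul_comm]
      abel
  -- Each contraction of `β ^ m = 0` trades a factor `β` for a covector, which is arbitrary since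
  -- `β` is nondegenerate; after `m` steps every product of `2 * m` covectors vanishes.
  have step : ∀ j ≤ m, ∀ l : List (V →ₗ[ℝ] ℝ), l.length = 2 * j →
      (l.map covector).prod * realForm β ^ (m - j) = 0 := by
    intro j
    induction j with
    | zero => intro _ l _; simp [h0]
    | succ j ih =>
      intro hj l hl
      have ih := ih (by omega)
      obtain ⟨a, l, rfl⟩ :=
        List.exists_cons_of_length_eq_add_one (n := 2 * j + 1) (l := l) (by omega)
      rcases l.eq_nil_or_concat with rfl | ⟨l, c, rfl⟩
      · simp at hl
        omega
      obtain ⟨v, rfl⟩ := hnd c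
      have hl' : l.length = 2 * j := by simp at hl; omega
      have h1 := congrArg (fun z ↦ covector a * contract v z) (ih l hl')
      simp only [map_zero, mul_zero, hsign, mul_add] at h1
      have h2 := aux (realForm β ^ (m - j)) v (2 * j) ih l [a] (by simp; omega)
      simp only [List.map_cons, List.map_nil, List.prod_cons, List.prod_nil, mul_one] at h2
      rw [← mul_assoc, h2, zero_add, show m - j = (m - (j + 1)) + 1 by omega,
        contract_realForm_pow hβ, mul_smul_comm, mul_smul_comm, mul_smul_comm,
        smul_smul] at h1
      have h3 := (smul_eq_zero.mp h1).resolve_left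
        (mul_ne_zero (pow_ne_zero _ (by norm_num)) (Nat.cast_add_one_ne_zero _))
      simpa [mul_assoc] using h3
  have hall : ∀ l : List (V →ₗ[ℝ] ℝ), l.length = 2 * m → (l.map covector).prod = 0 := by
    intro l hl
    simpa using step m le_rfl l hl
  -- The wedge of a dual basis is not zero: contract it with the basis vectors one after the other.
  have hbasis : ∀ l : List (Fin (Module.finrank ℝ V)), l.Nodup →
      ((l.map (Module.finBasis ℝ V).coord).map covector).prod ≠ (0 : ComplexForms V) := by
    intro l
    induction l with
    | nil => intro _; simp
    | cons i l ih =>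
      intro hl h
      rw [List.nodup_cons] at hl
      have hz : ∀ l : List (Fin (Module.finrank ℝ V)), i ∉ l →
          contract (Module.finBasis ℝ V i)
            ((l.map (Module.finBasis ℝ V).coord).map covector).prod = (0 : ComplexForms V) := by
        intro l
        induction l with
        | nil => intro _; simp [contract_one]
        | cons k l ih =>
          intro hk
          rw [List.mem_cons, not_or] at hk
          rw [List.map_cons, List.map_cons, List.prod_cons, contract_covector_mul, ih hk.2]
          simp [hk.1]
      have h' := congrArg (contract (Module.finBasis ℝ V i)) h
      rw [List.map_cons, List.map_cons, List.prod_cons, contract_covector_mul, hz l hl.1, map_zero,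
        mul_zero, sub_zero] at h'
      refine ih hl.2 ?_
      simpa using h'
  refine hbasis (List.finRange _) (List.nodup_finRange _) (hall _ ?_)
  simp [hm]

end Contraction

/-! ### Derivatives of traces and determinants -/

section Determinant

variable {E : Type*} [NormedAddCommGroup E] [NormedSpace ℝ E]

theorem det_mul_clm (A B : E →L[ℝ] E) :
    LinearMap.det (A * B).toLinearMap = LinearMap.det A.toLinearMap * LinearMap.det B.toLinearMap :=
  map_mul LinearMap.det A.toLinearMap B.toLinearMap

theorem det_ne_zero_of_mul_eq_one {A B : E →L[ℝ] E} (h : A * B = 1) :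
    LinearMap.det A.toLinearMap ≠ 0 := by
  have h1 := det_mul_clm A B
  rw [h] at h1
  intro h0
  rw [h0, zero_mul] at h1
  exact one_ne_zero (LinearMap.det_id.symm.trans h1)

variable [FiniteDimensional ℝ E]

/-- The trace as a continuous linear functional on the endomorphisms of `E`. -/
def traceCLM (E : Type*) [NormedAddCommGroup E] [NormedSpace ℝ E] [FiniteDimensional ℝ E] :
    (E →L[ℝ] E) →L[ℝ] ℝ :=
  LinearMap.toContinuousLinearMap (LinearMap.trace ℝ E ∘ₗ ContinuousLinearMap.coeLM ℝ)

theorem traceCLM_apply (A : E →L[ℝ] E) : traceCLM E A = LinearMap.trace ℝ E A.toLinearMap := rfl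

theorem traceCLM_mul_comm (A B : E →L[ℝ] E) : traceCLM E (A * B) = traceCLM E (B * A) :=
  LinearMap.trace_mul_comm ℝ A.toLinearMap B.toLinearMap

theorem contDiff_det : ContDiff ℝ ∞ fun A : E →L[ℝ] E ↦ LinearMap.det A.toLinearMap := by
  let b := Module.finBasis ℝ E
  have h : (fun A : E →L[ℝ] E ↦ LinearMap.det A.toLinearMap)
      = fun A ↦ ∑ σ : Equiv.Perm (Fin (Module.finrank ℝ E)), (Equiv.Perm.sign σ : ℤ) •
        ∏ i, b.equivFunL (A (b i)) (σ i) := by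
    funext A
    rw [← LinearMap.det_toMatrix b, Matrix.det_apply]
    refine Finset.sum_congr rfl fun σ _ ↦ ?_
    congr 1
    refine Finset.prod_congr rfl fun i _ ↦ ?_
    rw [LinearMap.toMatrix_apply]
    rfl
  rw [h]
  refine ContDiff.sum fun σ _ ↦ ?_
  have : ∀ (c : ℤ), ContDiff ℝ ∞ fun x : ℝ ↦ c • x := fun c ↦ by
    simp only [zsmul_eq_mul]; fun_prop
  refine (this _).comp (contDiff_prod fun i _ ↦ ?_)
  have : ContDiff ℝ ∞ fun A : E →L[ℝ] E ↦ b.equivFunL (A (b i)) := by fun_prop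
  exact contDiff_pi.mp this (σ i)

/-- Jacobi's formula along a line: `det (A + t X) = det A · det (1 + t A⁻¹ X)`, and the linear
coefficient of the second factor is a trace. -/
theorem hasDerivAt_det_line {A B : E →L[ℝ] E} (h : A * B = 1) (X : E →L[ℝ] E) :
    HasDerivAt (fun t : ℝ ↦ LinearMap.det (A + t • X).toLinearMap)
      (LinearMap.det A.toLinearMap * traceCLM E (B * X)) 0 := by
  let b := Module.finBasis ℝ E
  set M := LinearMap.toMatrix b b (B * X).toLinearMap with hM
  have h1 : (fun t : ℝ ↦ LinearMap.det (A + t • X).toLinearMap)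
      = fun t ↦ LinearMap.det A.toLinearMap
        * (Matrix.det (1 + (Polynomial.X : Polynomial ℝ) • M.map Polynomial.C)).eval t := by
    funext t
    have h2 : A + t • X = A * (1 + t • (B * X)) := by
      rw [mul_add, mul_one, mul_smul_comm, ← mul_assoc, h, one_mul]
    rw [h2, det_mul_clm]
    congr 1
    rw [← LinearMap.det_toMatrix b, ← Polynomial.coe_evalRingHom, RingHom.map_det]
    congr 1
    have h3 : (1 + t • (B * X)).toLinearMap = LinearMap.id + t • (B * X).toLinearMap := rfl
    rw [h3, map_add, map_smul, LinearMap.toMatrix_id, ← hM]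
    ext i j
    simp [Matrix.one_apply, apply_ite]
    exact mul_comm _ _
  rw [h1]
  have h4 := (Matrix.det (1 + (Polynomial.X : Polynomial ℝ) • M.map Polynomial.C)).hasDerivAt 0
  rw [Matrix.derivative_det_one_add_X_smul] at h4
  have h5 : traceCLM E (B * X) = M.trace := by
    rw [traceCLM_apply, LinearMap.trace_eq_matrix_trace ℝ b]
  rw [h5]
  exact h4.const_mul _

/-- Jacobi's formula, as a Fréchet derivative. -/
theorem fderiv_det {A B : E →L[ℝ] E} (h : A * B = 1) (X : E →L[ℝ] E) :
    fderiv ℝ (fun A : E →L[ℝ] E ↦ LinearMap.det A.toLinearMap) A X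
      = LinearMap.det A.toLinearMap * traceCLM E (B * X) := by
  have h1 : DifferentiableAt ℝ (fun A : E →L[ℝ] E ↦ LinearMap.det A.toLinearMap) A :=
    contDiff_det.differentiable (by simp) A
  have h2 : HasDerivAt (fun t : ℝ ↦ A + t • X) X 0 := by
    simpa using ((hasDerivAt_id (0 : ℝ)).smul_const X).const_add A
  have h3 : HasDerivAt (fun t : ℝ ↦ LinearMap.det (A + t • X).toLinearMap)
      (fderiv ℝ (fun A : E →L[ℝ] E ↦ LinearMap.det A.toLinearMap) A X) 0 := by
    have h1' : HasFDerivAt (fun A : E →L[ℝ] E ↦ LinearMap.det A.toLinearMap)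
        (fderiv ℝ (fun A : E →L[ℝ] E ↦ LinearMap.det A.toLinearMap) A) (A + (0 : ℝ) • X) := by
      simpa using h1.hasFDerivAt
    exact h1'.comp_hasDerivAt (0 : ℝ) h2
  exact h3.unique (hasDerivAt_det_line h X)

theorem hasDerivAt_det_comp {A : ℝ → E →L[ℝ] E} {A' B : E →L[ℝ] E} {s : ℝ} (h : A s * B = 1)
    (hA : HasDerivAt A A' s) :
    HasDerivAt (fun t ↦ LinearMap.det (A t).toLinearMap)
      (LinearMap.det (A s).toLinearMap * traceCLM E (B * A')) s := by
  rw [← fderiv_det h]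
  exact (contDiff_det.differentiable (by simp) (A s)).hasFDerivAt.comp_hasDerivAt s hA

end Determinant

/-! ### Two lemmas on paths -/

section Path

theorem pos_of_continuous_of_ne_zero {D : ℝ → ℝ} (hD : Continuous D)
    (hne : ∀ t ∈ Set.Icc (-1 : ℝ) 1, D t ≠ 0) (h1 : D (-1) = 1) {s : ℝ}
    (hs : s ∈ Set.Icc (-1 : ℝ) 1) : 0 < D s := by
  by_contra hle
  have hle : D s ≤ 0 := not_lt.mp hle
  obtain ⟨t, ht, h0⟩ := isPreconnected_Icc.intermediate_value hs (by norm_num) hD.continuousOn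
    (show (0 : ℝ) ∈ Set.Icc (D s) (D (-1)) from ⟨hle, by rw [h1]; norm_num⟩)
  exact hne t ht h0

/-- The derivative of the powers of an affine path in an algebra without topology, tested against
linear functionals. -/
theorem hasDerivAt_dual_pow {R : Type*} [Ring R] [Algebra ℂ R] {a b : R} (hab : Commute a b)
    (m : ℕ) (s : ℝ) (φ : R →ₗ[ℂ] ℂ) :
    HasDerivAt (fun t : ℝ ↦ φ (((t : ℂ) • a - b) ^ m))
      (m * φ (a * ((s : ℂ) • a - b) ^ (m - 1))) s := by
  induction m generalizing φ with
  | zero => simpa using hasDerivAt_const s (φ 1)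
  | succ m ih =>
    have h1 := ih (φ ∘ₗ LinearMap.mulLeft ℂ a)
    have h2 := ih (φ ∘ₗ LinearMap.mulLeft ℂ b)
    have h3 : HasDerivAt (fun t : ℝ ↦ (t : ℂ)) 1 s := Complex.ofRealCLM.hasDerivAt
    have h4 := (h3.mul h1).sub h2
    refine (h4.congr_deriv ?_).congr_of_eventuallyEq (.of_forall fun t ↦ ?_)
    · rcases m with _ | m
      · simp
      · have hc : Commute ((s : ℂ) • a - b) a :=
          ((Commute.refl a).smul_left _).sub_left hab.symm
        have h5 : φ (a * ((s : ℂ) • a - b) ^ (m + 1))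
            = s * φ (a * (a * ((s : ℂ) • a - b) ^ m)) - φ (b * (a * ((s : ℂ) • a - b) ^ m)) := by
          rw [pow_succ', ← mul_assoc, ← hc.eq, mul_assoc, sub_mul, smul_mul_assoc, map_sub,
            map_smul, smul_eq_mul]
        simp only [LinearMap.comp_apply, LinearMap.mulLeft_apply, Nat.add_sub_cancel]
        rw [h5]
        push_cast
        ring_nf
    · simp [pow_succ', sub_mul]

end Path

/-! ### The ratio of the pairings -/

section Pairing

variable {E : Type*} [NormedAddCommGroup E] [NormedSpace ℝ E]

theorem mul_clm_apply (A B : E →L[ℝ] E) (v : E) : (A * B) v = A (B v) := rfl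

theorem mul_clm_eq_one_symm [FiniteDimensional ℝ E] {A B : E →L[ℝ] E} (h : A * B = 1) :
    B * A = 1 := by
  have h1 : B.toLinearMap * A.toLinearMap = 1 :=
    mul_eq_one_comm.mp (congrArg ContinuousLinearMap.toLinearMap h :
      A.toLinearMap * B.toLinearMap = 1)
  ext v
  exact congrArg (fun A : E →ₗ[ℝ] E ↦ A v) h1

/-- The bilinear form `g(N ·, ·)`. -/
def lowered (g : E →L[ℝ] E →L[ℝ] ℝ) (N : E →L[ℝ] E) : E →ₗ[ℝ] E →ₗ[ℝ] ℝ :=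
  ContinuousLinearMap.coeLM ℝ ∘ₗ (g ∘L N).toLinearMap

theorem lowered_apply (g : E →L[ℝ] E →L[ℝ] ℝ) (N : E →L[ℝ] E) (v w : E) :
    lowered g N v w = g (N v) w := rfl

/-- Two orthogonal complex structures `I`, `J` at a point, with an inverse `S` of `[I, J]`. -/
structure IsPair (g : E →L[ℝ] E →L[ℝ] ℝ) (I J S : E →L[ℝ] E) : Prop where
  symm : ∀ v w, g v w = g w v
  pos : ∀ v, v ≠ 0 → 0 < g v v
  sq_left : I * I = -1
  sq_right : J * J = -1
  skew_left : ∀ v w, g (I v) w = -g v (I w)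
  skew_right : ∀ v w, g (J v) w = -g v (J w)
  mul_inv : (I * J - J * I) * S = 1
  inv_mul : S * (I * J - J * I) = 1

variable {g : E →L[ℝ] E →L[ℝ] ℝ} {I J S : E →L[ℝ] E}

/-- The Leibniz rule for `[I, J]`, when `I`, `J` are parallel for connections which differ by
`H`. -/
theorem commutator_leibniz {I J Γ H dI dJ : E →L[ℝ] E} (hI : dI = I * Γ - Γ * I)
    (hJ : dJ = J * (Γ + H) - (Γ + H) * J) :
    dI * J + I * dJ - (dJ * I + J * dI) = (I * J - J * I) * Γ - Γ * (I * J - J * I)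
      + (I * (J * H - H * J) - (J * H - H * J) * I) := by
  rw [hI, hJ]
  noncomm_ring

namespace IsPair

/-- `S` anticommutes with `I`, because `[I, J]` does: `g(S ·, ·)` has type `(2, 0) + (0, 2)`. -/
theorem anti_left (h : IsPair g I J S) : S * I = -(I * S) := by
  have h1 : I * (I * J - J * I) = -((I * J - J * I) * I) := by
    have h2 := h.sq_left
    simp only [mul_sub, sub_mul, ← mul_assoc, h2]
    simp only [mul_assoc, h2]
    noncomm_ring
  calc S * I = S * (I * (I * J - J * I)) * S := by rw [mul_assoc, mul_assoc, h.mul_inv, mul_one]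
    _ = -(S * (I * J - J * I) * (I * S)) := by rw [h1]; noncomm_ring
    _ = _ := by rw [h.inv_mul, one_mul]

theorem swap (h : IsPair g I J S) : IsPair g J I (-S) where
  symm := h.symm
  pos := h.pos
  sq_left := h.sq_right
  sq_right := h.sq_left
  skew_left := h.skew_right
  skew_right := h.skew_left
  mul_inv := by rw [← h.mul_inv]; noncomm_ring
  inv_mul := by rw [← h.inv_mul]; noncomm_ring

theorem anti_right (h : IsPair g I J S) : S * J = -(J * S) := by
  simpa [neg_eq_iff_eq_neg] using h.swap.anti_left

theorem mul_left_eq (h : IsPair g I J S) : I * S = -(S * I) := by rw [h.anti_left, neg_neg]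

theorem mul_right_eq (h : IsPair g I J S) : J * S = -(S * J) := by rw [h.anti_right, neg_neg]

theorem skew_inv (h : IsPair g I J S) (v w : E) : g (S v) w = -g v (S w) := by
  have h1 : ∀ a b, g ((I * J - J * I) a) b = -g a ((I * J - J * I) b) := by
    intro a b
    simp only [sub_apply, mul_clm_apply, map_sub, h.skew_left, h.skew_right]
    ring
  have h2 : ∀ a, (I * J - J * I) (S a) = a := fun a ↦ congrArg (fun T : E →L[ℝ] E ↦ T a) h.mul_inv
  have h3 := h1 (S v) (S w)
  rw [h2, h2] at h3
  linarith

theorem sub_mul_add (h : IsPair g I J S) : (I - J) * (I + J) = I * J - J * I := by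
  have h1 := h.sq_left
  have h2 := h.sq_right
  simp only [mul_add, sub_mul, h1, h2]
  noncomm_ring

theorem add_mul_sub (h : IsPair g I J S) : (I + J) * (I - J) = -(I * J - J * I) := by
  have h1 := h.sq_left
  have h2 := h.sq_right
  simp only [mul_sub, add_mul, h1, h2]
  noncomm_ring

theorem inv_add_mul (h : IsPair g I J S) : (S * (I - J)) * (I + J) = 1 := by
  rw [mul_assoc, h.sub_mul_add, h.inv_mul]

theorem inv_sub_mul (h : IsPair g I J S) : (S * (-I - J)) * (I - J) = 1 := by
  rw [mul_assoc, show -I - J = -(I + J) by abel, neg_mul, h.add_mul_sub, neg_neg, h.inv_mul]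

theorem mul_inv_add (h : IsPair g I J S) : (I + J) * (S * (I - J)) = 1 := by
  have : (I + J) * (S * (I - J)) = -(S * ((I + J) * (I - J))) := by
    have h1 : (I + J) * S = -(S * (I + J)) := by
      rw [mul_add, h.anti_left, h.anti_right]; noncomm_ring
    rw [← mul_assoc, h1, neg_mul, mul_assoc]
  rw [this, h.add_mul_sub, mul_neg, neg_neg, h.inv_mul]

theorem mul_inv_sub (h : IsPair g I J S) : (I - J) * (S * (-I - J)) = 1 := by
  have : (I - J) * (S * (-I - J)) = S * ((I - J) * (I + J)) := by
    have h1 : (I - J) * S = -(S * (I - J)) := by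
      rw [mul_sub, h.anti_left, h.anti_right]; noncomm_ring
    rw [← mul_assoc, h1, show -I - J = -(I + J) by abel]
    noncomm_ring
  rw [this, h.sub_mul_add, h.inv_mul]

theorem lowered_skew {N : E →L[ℝ] E} (hsymm : ∀ v w, g v w = g w v)
    (hN : ∀ v w, g (N v) w = -g v (N w)) (v w : E) : lowered g N v w = -lowered g N w v := by
  rw [lowered_apply, lowered_apply, hN, hsymm]

theorem path_skew (h : IsPair g I J S) (s : ℝ) (v w : E) :
    g ((S * (s • I - J)) v) w = -g v ((S * (s • I - J)) w) := by
  have e1 : ∀ a, S (I a) = -I (S a) := fun a ↦ congrArg (fun T : E →L[ℝ] E ↦ T a) h.anti_left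
  have e2 : ∀ a, S (J a) = -J (S a) := fun a ↦ congrArg (fun T : E →L[ℝ] E ↦ T a) h.anti_right
  simp only [mul_clm_apply, sub_apply, smul_apply, map_sub, map_smul, smul_eq_mul, e1, map_neg,
    neg_apply, e2, h.skew_left, h.skew_right, h.skew_inv]
  ring

theorem hasDerivAt_path (s : ℝ) : HasDerivAt (fun t : ℝ ↦ S * (t • I - J)) (S * I) s := by
  have h1 : (fun t : ℝ ↦ S * (t • I - J)) = fun t ↦ t • (S * I) - S * J := by
    funext t; rw [mul_sub, mul_smul_comm]
  rw [h1]
  simpa using ((hasDerivAt_id s).smul_const (S * I)).sub_const (S * J)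

variable [FiniteDimensional ℝ E]

/-- The members of the path `s I - J` are invertible: for `s² ≠ 1` because `I` and `J` are
isometries, and at the ends by nondegeneracy. -/
theorem exists_inv_path (h : IsPair g I J S) (s : ℝ) (hs : s ∈ Set.Icc (-1) 1) :
    ∃ T : E →L[ℝ] E, (S * (s • I - J)) * T = 1 := by
  rcases eq_or_ne s 1 with rfl | h1
  · exact ⟨I + J, by rw [one_smul, h.inv_add_mul]⟩
  rcases eq_or_ne s (-1) with rfl | h2
  · exact ⟨I - J, by rw [neg_one_smul, h.inv_sub_mul]⟩
  have hinj : Function.Injective (S * (s • I - J)).toLinearMap := by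
    rw [← LinearMap.ker_eq_bot, LinearMap.ker_eq_bot']
    intro v hv
    have hv' : (s • I - J) v = 0 := by
      have : (I * J - J * I) ((S * (s • I - J)) v) = 0 := by
        rw [show (S * (s • I - J)) v = 0 from hv, map_zero]
      rw [← mul_clm_apply, ← mul_assoc, h.mul_inv, one_mul] at this
      exact this
    have hv2 : s • I v = J v := sub_eq_zero.mp hv'
    have hI : g (I v) (I v) = g v v := by
      rw [h.skew_left, ← mul_clm_apply, h.sq_left]; simp
    have hJ : g (J v) (J v) = g v v := by
      rw [h.skew_right, ← mul_clm_apply, h.sq_right]; simp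
    rw [← hv2] at hJ
    simp only [map_smul, smul_apply, smul_eq_mul, hI] at hJ
    by_contra hne
    have hpos := h.pos v hne
    have : (s - 1) * (s + 1) * g v v = 0 := by linear_combination hJ
    rcases mul_eq_zero.mp this with h3 | h3
    · rcases mul_eq_zero.mp h3 with h4 | h4
      · exact h1 (sub_eq_zero.mp h4)
      · exact h2 (eq_neg_of_add_eq_zero_left h4)
    · exact hpos.ne' h3
  refine ⟨(LinearEquiv.ofInjectiveEndo _ hinj).symm.toLinearMap.toContinuousLinearMap, ?_⟩
  ext v
  exact (LinearEquiv.ofInjectiveEndo _ hinj).apply_symm_apply v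

theorem lowered_surjective (h : IsPair g I J S) {N T : E →L[ℝ] E} (hN : N * T = 1) :
    Function.Surjective (lowered g N) := by
  have hinj : Function.Injective (lowered g N) := by
    rw [← LinearMap.ker_eq_bot, LinearMap.ker_eq_bot']
    intro v hv
    have hTN : T * N = 1 := mul_clm_eq_one_symm hN
    have h2 : N v = 0 := by
      by_contra hne
      have h3 := h.pos _ hne
      have h4 : lowered g N v (N v) = 0 := by rw [hv]; rfl
      exact h3.ne' h4
    have : T (N v) = v := congrArg (fun A : E →L[ℝ] E ↦ A v) hTN
    rw [← this, h2, map_zero]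
  refine (LinearMap.injective_iff_surjective_of_finrank_eq_finrank ?_).mp hinj
  rw [Module.finrank_linearMap, Module.finrank_self, mul_one]

theorem realForm_path (s : ℝ) :
    realForm (lowered g (S * (s • I - J)))
      = (s : ℂ) • realForm (lowered g (S * I)) - realForm (lowered g (S * J)) := by
  rw [realForm, realForm, realForm, ← formElement_smul, formElement_sub]
  congr 1
  funext v w
  simp [lowered_apply]

theorem det_path_ratio_pos (h : IsPair g I J S) {s : ℝ} (hs : s ∈ Set.Icc (-1 : ℝ) 1) :
    0 < LinearMap.det (S * (s • I - J)).toLinearMap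
      / LinearMap.det (S * ((-1 : ℝ) • I - J)).toLinearMap := by
  set D : ℝ → ℝ := fun t ↦ LinearMap.det (S * (t • I - J)).toLinearMap
    / LinearMap.det (S * ((-1 : ℝ) • I - J)).toLinearMap with hD
  have hne : ∀ t ∈ Set.Icc (-1 : ℝ) 1, LinearMap.det (S * (t • I - J)).toLinearMap ≠ 0 := by
    intro t ht
    obtain ⟨T, hT⟩ := h.exists_inv_path t ht
    exact det_ne_zero_of_mul_eq_one hT
  have hm1 : (-1 : ℝ) ∈ Set.Icc (-1 : ℝ) 1 := by norm_num
  have hcont : Continuous D := by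
    have hp : Continuous fun t : ℝ ↦ S * (t • I - J) := by fun_prop
    have hc := contDiff_det.continuous.comp hp
    exact hc.div_const _
  exact pos_of_continuous_of_ne_zero hcont (fun t ht ↦ div_ne_zero (hne t ht) (hne _ hm1))
    (div_self (hne _ hm1)) hs

/-- Along the path `N_s = S (s I - J)`, which joins `(I - J)⁻¹` to `(I + J)⁻¹`, the Pfaffian and the
square root of the determinant satisfy the same linear differential equation. -/
theorem realForm_path_pow (h : IsPair g I J S) {m : ℕ} (hm : Module.finrank ℝ E = 2 * m) :
    realForm (lowered g (S * (I - J))) ^ m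
      = ((√(LinearMap.det (I - J).toLinearMap / LinearMap.det (I + J).toLinearMap) : ℝ) : ℂ) •
        realForm (lowered g (S * (-I - J))) ^ m := by
  set d : ℝ → ℝ := fun t ↦ LinearMap.det (S * (t • I - J)).toLinearMap
    / LinearMap.det (S * ((-1 : ℝ) • I - J)).toLinearMap with hd
  set F : ℝ → ComplexForms E := fun s ↦
    (s : ℂ) • realForm (lowered g (S * I)) - realForm (lowered g (S * J)) with hF
  have hpath : ∀ s, realForm (lowered g (S * (s • I - J))) = F s := fun s ↦ realForm_path s
  have hpos : ∀ s ∈ Set.Icc (-1 : ℝ) 1, 0 < d s := fun s hs ↦ h.det_path_ratio_pos hs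
  -- The exterior algebra carries no topology, so the quotient of the two solutions is shown to be
  -- constant after pairing it with linear functionals.
  have key : ∀ φ : ComplexForms E →ₗ[ℂ] ℂ, ∀ s ∈ Set.Icc (-1 : ℝ) 1,
      HasDerivAt (fun t ↦ φ (F t ^ m) / ((√(d t) : ℝ) : ℂ)) 0 s := by
    intro φ s hs
    obtain ⟨T, hT⟩ := h.exists_inv_path s hs
    have h1 := hasDerivAt_dual_pow
      (commute_formElement (fun v w ↦ (lowered g (S * I) v w : ℂ))
        (fun v w ↦ (lowered g (S * J) v w : ℂ))) m s φ
    have h2 := smul_realForm_mul_pow (γ := lowered g (S * I)) hm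
      (lowered_skew h.symm (h.path_skew s)) (T * (S * I)).toLinearMap (by
        intro v w
        have : (S * (s • I - J)) ((T * (S * I)) v) = (S * I) v := by
          rw [← mul_clm_apply, ← mul_assoc, hT, one_mul]
        exact (congrArg (fun u ↦ g u w) this).symm)
    rw [hpath] at h2
    have h3 := congrArg φ h2
    rw [map_smul, map_smul, smul_eq_mul, smul_eq_mul] at h3
    rw [show (↑m * φ (realForm (lowered g (S * I)) * ((s : ℂ) • realForm (lowered g (S * I))
      - realForm (lowered g (S * J))) ^ (m - 1))) = _ from h3] at h1
    have h4 := (hasDerivAt_det_comp hT (hasDerivAt_path s)).div_const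
      (LinearMap.det (S * ((-1 : ℝ) • I - J)).toLinearMap)
    have hds := hpos s hs
    have h5 := (h4.sqrt hds.ne').ofReal_comp
    have hsq : ((√(d s) : ℝ) : ℂ) ≠ 0 := Complex.ofReal_ne_zero.mpr (Real.sqrt_pos.mpr hds).ne'
    refine (h1.div h5 hsq).congr_deriv ?_
    rw [← traceCLM_apply]
    have h6 : (LinearMap.det (S * (s • I - J)).toLinearMap * traceCLM E (T * (S * I))
        / LinearMap.det (S * ((-1 : ℝ) • I - J)).toLinearMap) = √(d s) ^ 2
          * traceCLM E (T * (S * I)) := by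
      rw [Real.sq_sqrt hds.le]
      simp only [hd]
      ring
    rw [div_eq_zero_iff]
    left
    rw [h6]
    have hsq' := (Real.sqrt_pos.mpr hds).ne'
    have h7 : √(d s) ^ 2 * traceCLM E (T * (S * I)) / (2 * √(d s))
        = 1 / 2 * traceCLM E (T * (S * I)) * √(d s) := by
      field_simp
    rw [show LinearMap.det (S * (s • I - J)).toLinearMap
      / LinearMap.det (S * ((-1 : ℝ) • I - J)).toLinearMap = d s from rfl, h7]
    push_cast
    ring
  have hm1 : (-1 : ℝ) ∈ Set.Icc (-1 : ℝ) 1 := by norm_num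
  have h1 : (1 : ℝ) ∈ Set.Icc (-1 : ℝ) 1 := by norm_num
  have hd1 : d 1 = LinearMap.det (I - J).toLinearMap / LinearMap.det (I + J).toLinearMap := by
    have e1 := det_mul_clm (S * (I - J)) (I + J)
    have e2 := det_mul_clm (S * (-I - J)) (I - J)
    rw [h.inv_add_mul] at e1
    rw [h.inv_sub_mul, e1] at e2
    have n1 := det_ne_zero_of_mul_eq_one h.mul_inv_add
    have n2 := det_ne_zero_of_mul_eq_one h.inv_sub_mul
    simp only [hd, one_smul, neg_one_smul]
    rw [div_eq_div_iff n2 n1, e2, mul_comm]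
  have hdm1 : d (-1) = 1 := by
    obtain ⟨T, hT⟩ := h.exists_inv_path (-1) hm1
    exact div_self (det_ne_zero_of_mul_eq_one hT)
  have e1 := hpath 1
  have e2 := hpath (-1)
  rw [one_smul] at e1
  rw [neg_one_smul] at e2
  rw [e1, e2, ← sub_eq_zero, ← Module.forall_dual_apply_eq_zero_iff ℂ]
  intro φ
  have h2 := constant_of_has_deriv_right_zero
    (fun s hs ↦ (key φ s hs).continuousAt.continuousWithinAt)
    (fun s hs ↦ (key φ s (Set.Ico_subset_Icc_self hs)).hasDerivWithinAt) 1 h1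
  rw [hdm1, Real.sqrt_one, Complex.ofReal_one, div_one, hd1] at h2
  rw [map_sub, map_smul, sub_eq_zero, smul_eq_mul, ← h2]
  have : ((√(LinearMap.det (I - J).toLinearMap
      / LinearMap.det (I + J).toLinearMap) : ℝ) : ℂ) ≠ 0 := by
    rw [← hd1]
    exact Complex.ofReal_ne_zero.mpr (Real.sqrt_pos.mpr (hpos 1 h1)).ne'
  field_simp

theorem det_ratio_pos (h : IsPair g I J S) :
    0 < LinearMap.det (I - J).toLinearMap / LinearMap.det (I + J).toLinearMap := by
  have h1 := h.det_path_ratio_pos (s := 1) (by norm_num)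
  have e1 := det_mul_clm (S * (I - J)) (I + J)
  have e2 := det_mul_clm (S * (-I - J)) (I - J)
  rw [h.inv_add_mul] at e1
  rw [h.inv_sub_mul, e1] at e2
  have n1 := det_ne_zero_of_mul_eq_one h.mul_inv_add
  have n2 := det_ne_zero_of_mul_eq_one h.inv_sub_mul
  rw [one_smul, neg_one_smul] at h1
  convert h1 using 1
  rw [div_eq_div_iff n1 n2, mul_comm, ← e2]

theorem pairingPlus_eq (h : IsPair g I J S) {m : ℕ} (hm : Module.finrank ℝ E = 2 * m) :
    pairingPlus g I J = ((m.factorial : ℂ)⁻¹ * (4 * Complex.I) ^ m) •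
      realForm (lowered g (S * (I - J))) ^ m := by
  have hinv : ContinuousLinearMap.inverse (I + J) = S * (I - J) :=
    ContinuousLinearMap.inverse_eq h.mul_inv_add h.inv_add_mul
  rw [pairingPlus, mukai_spinor hm, mul_smul, ← smul_pow, realForm, ← formElement_smul]
  congr 3
  funext v w
  simp only [taming, hinv, lowered_apply]
  push_cast
  ring

theorem pairingMinus_eq (h : IsPair g I J S) {m : ℕ} (hm : Module.finrank ℝ E = 2 * m) :
    pairingMinus g I J = ((m.factorial : ℂ)⁻¹ * (4 * Complex.I) ^ m) •
      realForm (lowered g (S * (-I - J))) ^ m := by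
  have hinv : ContinuousLinearMap.inverse (I - J) = S * (-I - J) :=
    ContinuousLinearMap.inverse_eq h.mul_inv_sub h.inv_sub_mul
  rw [pairingMinus, mukai_spinor hm, mul_smul, ← smul_pow, realForm, ← formElement_smul]
  congr 3
  funext v w
  simp only [taming, hinv, lowered_apply]
  push_cast
  ring

theorem pairingMinus_ne_zero (h : IsPair g I J S) {m : ℕ} (hm : Module.finrank ℝ E = 2 * m) :
    pairingMinus g I J ≠ 0 := by
  rw [h.pairingMinus_eq hm]
  refine smul_ne_zero (mul_ne_zero (inv_ne_zero ?_) (pow_ne_zero _ ?_)) ?_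
  · exact Nat.cast_ne_zero.mpr (Nat.factorial_ne_zero m)
  · simp
  · have hs := h.path_skew (-1)
    rw [neg_one_smul] at hs
    exact realForm_pow_ne_zero hm (lowered_skew h.symm hs) (h.lowered_surjective h.inv_sub_mul)

/-- The ratio of the two pairings, as a determinant. -/
theorem pairingPlus_eq_smul (h : IsPair g I J S) {m : ℕ} (hm : Module.finrank ℝ E = 2 * m) :
    pairingPlus g I J
      = ((√(LinearMap.det (I - J).toLinearMap / LinearMap.det (I + J).toLinearMap) : ℝ) : ℂ) •
        pairingMinus g I J := by
  rw [h.pairingPlus_eq hm, h.pairingMinus_eq hm, h.realForm_path_pow hm, smul_comm]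

theorem formRatio_pairing (h : IsPair g I J S) {m : ℕ} (hm : Module.finrank ℝ E = 2 * m) :
    formRatio (pairingPlus g I J) (pairingMinus g I J)
      = ((√(LinearMap.det (I - J).toLinearMap / LinearMap.det (I + J).toLinearMap) : ℝ) : ℂ) := by
  have h1 : pairingPlus g I J
      = formRatio (pairingPlus g I J) (pairingMinus g I J) • pairingMinus g I J :=
    Classical.epsilon_spec (p := fun c : ℂ ↦ pairingPlus g I J = c • pairingMinus g I J)
      ⟨_, h.pairingPlus_eq_smul hm⟩
  exact smul_left_injective ℂ (h.pairingMinus_ne_zero hm) (h1.symm.trans (h.pairingPlus_eq_smul hm))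

end IsPair
end Pairing

/-! ### The Bismut connection of a Hermitian structure -/

section HermitianCalculus

variable {E : Type*} [NormedAddCommGroup E] [NormedSpace ℝ E]

/-- A Hermitian structure on the open subset `U` of the model space. Orthogonality of `I` is stated
as skewness, which is equivalent as `I² = -1`. -/
structure IsLocalHermitian (U : Set E) (g : E → E →L[ℝ] E →L[ℝ] ℝ) (I : E → E →L[ℝ] E) :
    Prop where
  isOpen : IsOpen U
  smooth_metric : ContDiffOn ℝ ∞ g U
  smooth : ContDiffOn ℝ ∞ I U
  symm : ∀ y ∈ U, ∀ v w, g y v w = g y w v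
  pos : ∀ y ∈ U, ∀ v, v ≠ 0 → 0 < g y v v
  sq : ∀ y ∈ U, I y * I y = -1
  skew : ∀ y ∈ U, ∀ v w, g y (I y v) w = -g y v (I y w)
  integrable : ∀ y ∈ U, ∀ v w, nijenhuis I y v w = 0

theorem extDeriv_two_apply {η : E → E [⋀^Fin 2]→L[ℝ] ℝ} {y : E} (hη : DifferentiableAt ℝ η y)
    (u v w : E) :
    extDeriv η y ![u, v, w]
      = fderiv ℝ (fun z ↦ η z ![v, w]) y u + fderiv ℝ (fun z ↦ η z ![w, u]) y v
        + fderiv ℝ (fun z ↦ η z ![u, v]) y w := by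
  have h1 : (fun z ↦ η z ![u, w]) = -fun z ↦ η z ![w, u] := by
    funext z
    have := (η z).toAlternatingMap.map_swap ![w, u] (i := 0) (j := 1) (by decide)
    have h2 : ![w, u] ∘ Equiv.swap (0 : Fin 2) 1 = ![u, w] := by
      funext i; fin_cases i <;> rfl
    rw [h2] at this
    exact this
  rw [extDeriv_apply hη, Fin.sum_univ_three]
  have r0 : Fin.removeNth 0 ![u, v, w] = ![v, w] := by funext i; fin_cases i <;> rfl
  have r1 : Fin.removeNth 1 ![u, v, w] = ![u, w] := by funext i; fin_cases i <;> rfl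
  have r2 : Fin.removeNth 2 ![u, v, w] = ![u, v] := by funext i; fin_cases i <;> rfl
  rw [r0, r1, r2, h1, fderiv_neg]
  simp

theorem extDeriv_one_apply {η : E → E →L[ℝ] ℝ} {y : E} (hη : DifferentiableAt ℝ η y) (v w : E) :
    extDeriv (fun z ↦ ContinuousAlternatingMap.ofSubsingletonLIE (𝕜 := ℝ) (E := E) (F := ℝ)
      (0 : Fin 1) (η z)) y ![v, w] = fderiv ℝ η y v w - fderiv ℝ η y w v := by
  have hd : HasFDerivAt (fun z ↦ ContinuousAlternatingMap.ofSubsingletonLIE (𝕜 := ℝ) (E := E)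
      (F := ℝ) (0 : Fin 1) (η z)) ((ContinuousAlternatingMap.ofSubsingletonLIE (𝕜 := ℝ) (E := E)
      (F := ℝ) (0 : Fin 1)).toContinuousLinearEquiv.toContinuousLinearMap ∘L fderiv ℝ η y) y :=
    (ContinuousAlternatingMap.ofSubsingletonLIE (𝕜 := ℝ) (E := E)
      (F := ℝ) (0 : Fin 1)).toContinuousLinearEquiv.toContinuousLinearMap.hasFDerivAt.comp y
      hη.hasFDerivAt
  have hc : ∀ a x, fderiv ℝ (fun z ↦ η z a) y x = fderiv ℝ η y x a := by
    intro a x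
    rw [(hη.hasFDerivAt.clm_apply (hasFDerivAt_const a y)).fderiv]
    simp
  rw [extDeriv_apply hd.differentiableAt, Fin.sum_univ_two]
  simp [Fin.removeNth, sub_eq_add_neg, hc]

theorem dcOmega_apply (g : E → E →L[ℝ] E →L[ℝ] ℝ) (I : E → E →L[ℝ] E) (y u v w : E) :
    dcOmega g I y ![u, v, w] = -extDeriv (fundamentalForm g I) y ![I y u, I y v, I y w] := by
  rw [dcOmega]
  simp only [ContinuousAlternatingMap.neg_apply,
    ContinuousAlternatingMap.compContinuousLinearMap_apply]
  congr 2
  funext i; fin_cases i <;> rfl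

namespace IsLocalHermitian

variable {U : Set E} {g : E → E →L[ℝ] E →L[ℝ] ℝ} {I : E → E →L[ℝ] E} {y : E}

theorem mem_nhds (h : IsLocalHermitian U g I) (hy : y ∈ U) : U ∈ nhds y := h.isOpen.mem_nhds hy

theorem contDiffAt_metric (h : IsLocalHermitian U g I) (hy : y ∈ U) : ContDiffAt ℝ ∞ g y :=
  h.smooth_metric.contDiffAt (h.mem_nhds hy)

theorem contDiffAt (h : IsLocalHermitian U g I) (hy : y ∈ U) : ContDiffAt ℝ ∞ I y :=
  h.smooth.contDiffAt (h.mem_nhds hy)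

theorem differentiableAt_metric (h : IsLocalHermitian U g I) (hy : y ∈ U) :
    DifferentiableAt ℝ g y := (h.contDiffAt_metric hy).differentiableAt (by simp)

theorem differentiableAt (h : IsLocalHermitian U g I) (hy : y ∈ U) :
    DifferentiableAt ℝ I y := (h.contDiffAt hy).differentiableAt (by simp)

theorem apply_apply (h : IsLocalHermitian U g I) (hy : y ∈ U) (v : E) : I y (I y v) = -v :=
  congrArg (fun T : E →L[ℝ] E ↦ T v) (h.sq y hy)

theorem hasFDerivAt_metric_apply (h : IsLocalHermitian U g I) (hy : y ∈ U) (a b : E) :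
    HasFDerivAt (fun z ↦ g z a b) (((fderiv ℝ g y).flip a).flip b) y := by
  have h1 := (h.differentiableAt_metric hy).hasFDerivAt
  refine ((h1.clm_apply (hasFDerivAt_const a y)).clm_apply (hasFDerivAt_const b y)).congr_fderiv ?_
  ext x
  simp

theorem hasFDerivAt_form_apply (h : IsLocalHermitian U g I) (hy : y ∈ U) (a b : E) :
    HasFDerivAt (fun z ↦ g z (I z a) b)
      (((fderiv ℝ g y).flip (I y a)).flip b + (g y).flip b ∘L (fderiv ℝ I y).flip a) y := by
  have h1 := (h.differentiableAt_metric hy).hasFDerivAt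
  have h2 := (h.differentiableAt hy).hasFDerivAt
  refine ((h1.clm_apply (h2.clm_apply (hasFDerivAt_const a y))).clm_apply
    (hasFDerivAt_const b y)).congr_fderiv ?_
  ext x
  simp [add_comm]

theorem fderiv_metric_symm (h : IsLocalHermitian U g I) (hy : y ∈ U) (x a b : E) :
    fderiv ℝ g y x a b = fderiv ℝ g y x b a := by
  have h1 := (h.hasFDerivAt_metric_apply hy a b).congr_of_eventuallyEq
    (f₁ := fun z ↦ g z b a)
    (Filter.eventually_of_mem (h.mem_nhds hy) fun z hz ↦ h.symm z hz b a)
  have h2 := h1.unique (h.hasFDerivAt_metric_apply hy b a)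
  simpa using congrArg (fun T : E →L[ℝ] ℝ ↦ T x) h2

/-- The derivative of the skewness of `g(I ·, ·)`. -/
theorem fderiv_skew (h : IsLocalHermitian U g I) (hy : y ∈ U) (x a b : E) :
    fderiv ℝ g y x (I y a) b + g y (fderiv ℝ I y x a) b
      = -(fderiv ℝ g y x (I y b) a + g y (fderiv ℝ I y x b) a) := by
  have h1 := (h.hasFDerivAt_form_apply hy a b).congr_of_eventuallyEq
    (f₁ := fun z ↦ -g z (I z b) a)
    (Filter.eventually_of_mem (h.mem_nhds hy) fun z hz ↦ by
      simp only [h.skew z hz b a, neg_neg, h.symm z hz b])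
  have h2 := h1.unique (h.hasFDerivAt_form_apply hy b a).neg
  simpa using congrArg (fun T : E →L[ℝ] ℝ ↦ T x) h2

/-- The derivative of `I² = -1`. -/
theorem fderiv_anti (h : IsLocalHermitian U g I) (hy : y ∈ U) (x : E) :
    fderiv ℝ I y x * I y = -(I y * fderiv ℝ I y x) := by
  have h1 := (h.differentiableAt hy).hasFDerivAt
  have h2 := (h1.clm_comp h1).congr_of_eventuallyEq
    (f₁ := fun _ ↦ -ContinuousLinearMap.id ℝ E)
    (Filter.eventually_of_mem (h.mem_nhds hy) fun z hz ↦ (h.sq z hz).symm)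
  have h3 := h2.unique (hasFDerivAt_const _ y)
  have h4 := congrArg (fun T : E →L[ℝ] (E →L[ℝ] E) ↦ T x) h3
  simp at h4
  rw [eq_neg_iff_add_eq_zero, add_comm]
  exact h4

theorem fderiv_anti_inner (h : IsLocalHermitian U g I) (hy : y ∈ U) (x a b : E) :
    g y (fderiv ℝ I y x (I y a)) b = g y (fderiv ℝ I y x a) (I y b) := by
  have h1 : fderiv ℝ I y x (I y a) = -(I y (fderiv ℝ I y x a)) :=
    congrArg (fun T : E →L[ℝ] E ↦ T a) (h.fderiv_anti hy x)
  rw [h1, map_neg, neg_apply, h.skew y hy, neg_neg]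

/-- The vanishing of the Nijenhuis tensor, in terms of the derivatives of `I`. -/
theorem nijenhuis_inner (h : IsLocalHermitian U g I) (hy : y ∈ U) (v w u : E) :
    g y (fderiv ℝ I y (I y v) w) u - g y (fderiv ℝ I y (I y w) v) u
      - g y (fderiv ℝ I y w v) (I y u) + g y (fderiv ℝ I y v w) (I y u) = 0 := by
  have hd : ∀ a x, fderiv ℝ (fun z ↦ I z a) y x = fderiv ℝ I y x a := by
    intro a x
    have := ((h.differentiableAt hy).hasFDerivAt.clm_apply (hasFDerivAt_const a y)).fderiv
    rw [this]
    simp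
  have h1 := congrArg (fun a ↦ g y a u) (h.integrable y hy v w)
  simp only [nijenhuis, VectorField.lieBracket, hd, fderiv_fun_const, Pi.zero_apply,
    zero_apply, map_sub, sub_apply, map_zero, zero_sub, sub_zero, map_neg, neg_apply,
    h.skew y hy (fderiv ℝ I y _ _)] at h1
  linarith

theorem fundamentalForm_apply (h : IsLocalHermitian U g I) (hy : y ∈ U) (a b : E) :
    fundamentalForm g I y ![a, b] = g y (I y a) b := by
  rw [fundamentalForm, twoForm_apply]
  simp only [ContinuousLinearMap.comp_apply]
  rw [h.skew y hy b a, h.symm y hy b]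
  ring

theorem contDiffAt_fundamentalForm (h : IsLocalHermitian U g I) (hy : y ∈ U) :
    ContDiffAt ℝ ∞ (fundamentalForm g I) y := by
  have h1 : ContDiffAt ℝ ∞ (fun z ↦ g z ∘L I z) y :=
    (h.contDiffAt_metric hy).clm_comp (h.contDiffAt hy)
  have h2 : ∃ T : (E →L[ℝ] E →L[ℝ] ℝ) →L[ℝ] (E [⋀^Fin 2]→L[ℝ] ℝ), ∀ B, T B = twoForm B := by
    refine ⟨(1 / 2 : ℝ) • ContinuousAlternatingMap.alternatizeUncurryFinCLM ℝ E ℝ ∘L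
      ContinuousLinearMap.compL ℝ E (E →L[ℝ] ℝ) (E [⋀^Fin 1]→L[ℝ] ℝ)
      ((ContinuousAlternatingMap.ofSubsingletonLIE (𝕜 := ℝ) (E := E) (F := ℝ)
      (0 : Fin 1)).toContinuousLinearEquiv.toContinuousLinearMap), fun B ↦ rfl⟩
  obtain ⟨T, hT⟩ := h2
  have h3 : fundamentalForm g I = fun z ↦ T (g z ∘L I z) := by
    funext z; rw [hT]; rfl
  rw [h3]
  exact T.contDiff.contDiffAt.comp y h1

theorem fderiv_fundamentalForm (h : IsLocalHermitian U g I) (hy : y ∈ U) (x a b : E) :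
    fderiv ℝ (fun z ↦ fundamentalForm g I z ![a, b]) y x
      = fderiv ℝ g y x (I y a) b + g y (fderiv ℝ I y x a) b := by
  have h2 := (h.hasFDerivAt_form_apply hy a b).congr_of_eventuallyEq
    (f₁ := fun z ↦ fundamentalForm g I z ![a, b])
    (Filter.eventually_of_mem (h.mem_nhds hy) fun z hz ↦ h.fundamentalForm_apply hz a b)
  rw [h2.fderiv]
  simp

theorem extDeriv_fundamentalForm (h : IsLocalHermitian U g I) (hy : y ∈ U) (u v w : E) :
    extDeriv (fundamentalForm g I) y ![u, v, w]
      = (fderiv ℝ g y u (I y v) w + g y (fderiv ℝ I y u v) w)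
        + (fderiv ℝ g y v (I y w) u + g y (fderiv ℝ I y v w) u)
        + (fderiv ℝ g y w (I y u) v + g y (fderiv ℝ I y w u) v) := by
  rw [extDeriv_two_apply ((h.contDiffAt_fundamentalForm hy).differentiableAt (by simp)),
    h.fderiv_fundamentalForm hy, h.fderiv_fundamentalForm hy, h.fderiv_fundamentalForm hy]

/-- Since `I` is integrable, `dω` has no component of type `(3, 0) + (0, 3)`. -/
theorem extDeriv_fundamentalForm_type (h : IsLocalHermitian U g I) (hy : y ∈ U) (v w u : E) :
    extDeriv (fundamentalForm g I) y ![v, w, u]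
      = extDeriv (fundamentalForm g I) y ![v, I y w, I y u]
      + extDeriv (fundamentalForm g I) y ![I y v, w, I y u]
      + extDeriv (fundamentalForm g I) y ![I y v, I y w, u] := by
  have skew := h.fderiv_skew hy
  have anti := h.fderiv_anti_inner hy
  have nij := h.nijenhuis_inner hy
  have symm := h.fderiv_metric_symm hy
  simp only [h.extDeriv_fundamentalForm hy]
  -- Three instances of the vanishing of the Nijenhuis tensor give the claim, up to the derivatives
  -- of the algebraic relations between `g` and `I`.
  have n1 := nij (I y v) w u
  have n2 := nij u v (I y w)
  have n3 := nij u w (I y v)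
  have s1 := skew v u w
  have s2 := skew (I y v) u (I y w)
  have s3 := skew w u v
  have s4 := skew (I y w) u (I y v)
  have s5 := skew u v w
  have s6 := skew (I y u) (I y v) w
  have a1 := anti v w (I y u)
  have a2 := anti w v (I y u)
  have a3 := anti w u (I y v)
  have a4 := anti (I y w) u v
  have a5 := anti u v (I y w)
  simp only [h.apply_apply hy, map_neg, neg_apply] at *
  linarith [symm v w u, symm v w (I y u), symm v (I y w) u, symm v (I y w) (I y u), symm (I y v)
    w u, symm (I y v) w (I y u), symm (I y v) (I y w) u, symm (I y v) (I y w) (I y u), symm w v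
    u, symm w v (I y u), symm w (I y v) u, symm w (I y v) (I y u), symm (I y w) v u, symm (I y
    w) v (I y u), symm (I y w) (I y v) u, symm (I y w) (I y v) (I y u), symm u v w, symm u v (I
    y w), symm u (I y v) w, symm u (I y v) (I y w), symm (I y u) v w, symm (I y u) v (I y w),
    symm (I y u) (I y v) w, symm (I y u) (I y v) (I y w)]

/-- The torsion 3-form has no component of type `(3, 0) + (0, 3)`. -/
theorem dcOmega_type (h : IsLocalHermitian U g I) (hy : y ∈ U) (u v w : E) :
    dcOmega g I y ![u, v, w] = dcOmega g I y ![u, I y v, I y w]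
      + dcOmega g I y ![I y u, v, I y w] + dcOmega g I y ![I y u, I y v, w] := by
  have h1 := h.extDeriv_fundamentalForm_type hy (I y u) (I y v) (I y w)
  simp only [dcOmega_apply, h.extDeriv_fundamentalForm hy, h.apply_apply hy, map_neg,
    neg_apply] at *
  linarith

/-- The Bismut connection preserves the complex structure. -/
theorem fderiv_eq_commutator (h : IsLocalHermitian U g I) (hg : (g y).IsInvertible)
    (hy : y ∈ U) (v : E) :
    fderiv ℝ I y v = I y * bismutForm g I y v - bismutForm g I y v * I y := by
  have skew := h.fderiv_skew hy
  have anti := h.fderiv_anti_inner hy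
  have nij := h.nijenhuis_inner hy
  have symm := h.fderiv_metric_symm hy
  ext w
  refine hg.injective ?_
  ext u
  -- After pairing with `u` this is a linear combination of two instances of the vanishing of the
  -- Nijenhuis tensor and of derivatives of the algebraic relations between `g` and `I`.
  have n1 := nij (I y v) w u
  have n2 := nij u (I y v) w
  have s1 := skew v u w
  have s2 := skew (I y v) u (I y w)
  have s3 := skew w u v
  have s4 := skew (I y w) u (I y v)
  have a1 := anti w v (I y u)
  have a2 := anti w u (I y v)
  simp only [sub_apply, mul_clm_apply, map_sub, h.skew y hy (bismutForm g I y v w),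
    bismutForm_inner g I y _ _ _ hg, christoffel_apply, dcOmega_apply,
    h.extDeriv_fundamentalForm hy, h.apply_apply hy, map_neg, neg_apply] at *
  linarith [symm v w u, symm v w (I y u), symm v (I y w) u, symm v (I y w) (I y u), symm (I y v)
    w u, symm (I y v) w (I y u), symm (I y v) (I y w) u, symm (I y v) (I y w) (I y u), symm w v
    u, symm w v (I y u), symm w (I y v) u, symm w (I y v) (I y u), symm (I y w) v u, symm (I y
    w) v (I y u), symm (I y w) (I y v) u, symm (I y w) (I y v) (I y u), symm u v w, symm u v (I
    y w), symm u (I y v) w, symm u (I y v) (I y w), symm (I y u) v w, symm (I y u) v (I y w),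
    symm (I y u) (I y v) w, symm (I y u) (I y v) (I y w)]

end IsLocalHermitian
end HermitianCalculus

/-! ### Smoothness of the Bismut connection -/

section BismutSmooth

variable {E : Type*} [NormedAddCommGroup E] [NormedSpace ℝ E] [FiniteDimensional ℝ E]
  {U : Set E} {g : E → E →L[ℝ] E →L[ℝ] ℝ} {I : E → E →L[ℝ] E} {y : E}

theorem isInvertible_of_pos {g : E →L[ℝ] E →L[ℝ] ℝ} (hpos : ∀ v, v ≠ 0 → 0 < g v v) :
    g.IsInvertible := by
  have hinj : Function.Injective (ContinuousLinearMap.coeLM ℝ ∘ₗ g.toLinearMap :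
      E →ₗ[ℝ] (E →ₗ[ℝ] ℝ)) := by
    rw [← LinearMap.ker_eq_bot, LinearMap.ker_eq_bot']
    intro v hv
    by_contra hne
    exact (hpos v hne).ne' (congrArg (fun T : E →ₗ[ℝ] ℝ ↦ T v) hv)
  have hsurj := (LinearMap.injective_iff_surjective_of_finrank_eq_finrank
    (by rw [Module.finrank_linearMap, Module.finrank_self, mul_one])).mp hinj
  have hb : Function.Bijective g := by
    refine ⟨fun a b hab ↦ hinj ?_, fun α ↦ ?_⟩
    · exact congrArg ContinuousLinearMap.toLinearMap hab
    · obtain ⟨v, hv⟩ := hsurj α.toLinearMap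
      exact ⟨v, ContinuousLinearMap.coe_injective hv⟩
  exact ⟨(LinearEquiv.ofBijective g.toLinearMap hb).toContinuousLinearEquiv, rfl⟩

namespace IsLocalHermitian

theorem isInvertible (h : IsLocalHermitian U g I) (hy : y ∈ U) : (g y).IsInvertible :=
  isInvertible_of_pos (h.pos y hy)

theorem contDiffOn_bismutForm (h : IsLocalHermitian U g I) :
    ContDiffOn ℝ ∞ (bismutForm g I) U := by
  have hg := h.smooth_metric
  have hI := h.smooth
  have hdg : ContDiffOn ℝ ∞ (fderiv ℝ g) U := hg.fderiv_of_isOpen h.isOpen (by simp)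
  have hdI : ContDiffOn ℝ ∞ (fderiv ℝ I) U := hI.fderiv_of_isOpen h.isOpen (by simp)
  have hinv : ContDiffOn ℝ ∞ (fun z ↦ ContinuousLinearMap.inverse (g z)) U := by
    intro z hz
    obtain ⟨e, he⟩ := h.isInvertible hz
    have h1 : ContDiffAt ℝ ∞ ContinuousLinearMap.inverse (g z) := by
      have : CompleteSpace E := FiniteDimensional.complete ℝ E
      rw [← he]
      exact contDiffAt_map_inverse e
    exact (h1.comp z (h.contDiffAt_metric hz)).contDiffWithinAt
  -- In components `d ω` is a polynomial in `g`, `I` and their first derivatives.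
  have hc : ∀ v w u, ContDiffOn ℝ ∞ (fun z ↦
      (christoffel g z - (1 / 2 : ℝ) • trilinear (dcOmega g I z)) v w u) U := by
    intro v w u
    have hcg : ∀ {a b c : E → E}, ContDiffOn ℝ ∞ a U → ContDiffOn ℝ ∞ b U →
        ContDiffOn ℝ ∞ c U → ContDiffOn ℝ ∞ (fun z ↦ fderiv ℝ g z (a z) (b z) (c z)) U :=
      fun ha hb hc ↦ ((hdg.clm_apply ha).clm_apply hb).clm_apply hc
    have hcI : ∀ {a b c : E → E}, ContDiffOn ℝ ∞ a U → ContDiffOn ℝ ∞ b U →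
        ContDiffOn ℝ ∞ c U → ContDiffOn ℝ ∞ (fun z ↦ g z (fderiv ℝ I z (a z) (b z)) (c z)) U :=
      fun ha hb hc ↦ (hg.clm_apply ((hdI.clm_apply ha).clm_apply hb)).clm_apply hc
    have c0 : ∀ v : E, ContDiffOn ℝ ∞ (fun _ : E ↦ v) U := fun v ↦ contDiffOn_const
    have c1 : ∀ v : E, ContDiffOn ℝ ∞ (fun z : E ↦ I z v) U := fun v ↦ hI.clm_apply (c0 v)
    have c2 : ∀ v : E, ContDiffOn ℝ ∞ (fun z : E ↦ I z (I z v)) U := fun v ↦ hI.clm_apply (c1 v)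
    have key : ∀ z ∈ U, (christoffel g z - (1 / 2 : ℝ) • trilinear (dcOmega g I z)) v w u
        = (1 / 2) * (fderiv ℝ g z v w u + fderiv ℝ g z w v u - fderiv ℝ g z u v w)
          + (1 / 2) * (
          (fderiv ℝ g z (I z v) (I z (I z w)) (I z u)
            + g z (fderiv ℝ I z (I z v) (I z w)) (I z u))
          + (fderiv ℝ g z (I z w) (I z (I z u)) (I z v)
            + g z (fderiv ℝ I z (I z w) (I z u)) (I z v))
          + (fderiv ℝ g z (I z u) (I z (I z v)) (I z w)
            + g z (fderiv ℝ I z (I z u) (I z v)) (I z w))) := by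
      intro z hz
      simp only [sub_apply, smul_apply, smul_eq_mul, trilinear_apply, christoffel_apply,
        dcOmega_apply, h.extDeriv_fundamentalForm hz]
      ring
    refine ContDiffOn.congr ?_ key
    refine (contDiffOn_const.mul (((hcg (c0 _) (c0 _) (c0 _)).add (hcg (c0 _) (c0 _) (c0 _))).sub
      (hcg (c0 _) (c0 _) (c0 _)))).add (contDiffOn_const.mul ?_)
    exact (((hcg (c1 _) (c2 _) (c1 _)).add (hcI (c1 _) (c1 _) (c1 _))).add
      ((hcg (c1 _) (c2 _) (c1 _)).add (hcI (c1 _) (c1 _) (c1 _)))).add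
      ((hcg (c1 _) (c2 _) (c1 _)).add (hcI (c1 _) (c1 _) (c1 _)))
  refine contDiffOn_clm_apply.mpr fun v ↦ contDiffOn_clm_apply.mpr fun w ↦ ?_
  have : ContDiffOn ℝ ∞ (fun z ↦
      (christoffel g z - (1 / 2 : ℝ) • trilinear (dcOmega g I z)) v w) U :=
    contDiffOn_clm_apply.mpr fun u ↦ hc v w u
  exact hinv.clm_apply this

end IsLocalHermitian
end BismutSmooth

/-! ### Trace identities for a pair of complex structures -/

section TraceIdentities

variable {E : Type*} [NormedAddCommGroup E] [NormedSpace ℝ E] [FiniteDimensional ℝ E]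
  {g : E →L[ℝ] E →L[ℝ] ℝ} {I J S : E →L[ℝ] E}

namespace IsPair

theorem trace_mul_right (h : IsPair g I J S) (A : E →L[ℝ] E) :
    traceCLM E (S * A * J) = -traceCLM E (S * J * A) := by
  rw [traceCLM_mul_comm, ← mul_assoc, h.mul_right_eq, neg_mul, map_neg]

/-- The logarithmic derivative of `det (I - J) / det (I + J)` when `I`, `J` are parallel for
connections whose difference is `H`. -/
theorem trace_log_deriv (h : IsPair g I J S) {Γ H dI dJ : E →L[ℝ] E} (hI : dI = I * Γ - Γ * I)
    (hJ : dJ = J * (Γ + H) - (Γ + H) * J) :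
    (1 / 2) * (traceCLM E (S * (-I - J) * (dI - dJ)) - traceCLM E (S * (I - J) * (dI + dJ)))
      = -2 * traceCLM E (S * H) := by
  have key : ∀ {I J S : E →L[ℝ] E}, IsPair g I J S → ∀ A : E →L[ℝ] E,
      traceCLM E (S * I * (I * A - A * I)) = -2 * traceCLM E (S * A) := by
    intro I J S h A
    have h1 : S * I * (I * A) = -(S * A) := by
      rw [mul_assoc, ← mul_assoc I, h.sq_left]; noncomm_ring
    have h2 : traceCLM E (S * I * (A * I)) = traceCLM E (S * A) := by
      rw [← mul_assoc, traceCLM_mul_comm, ← mul_assoc, ← mul_assoc, ← neg_neg (I * S),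
        ← h.anti_left, neg_mul, mul_assoc S, h.sq_left]
      simp
    rw [mul_sub, map_sub, h1, h2, map_neg]
    ring
  have h1 : S * (-I - J) * (dI - dJ) - S * (I - J) * (dI + dJ)
      = (2 : ℝ) • (S * J * dJ) - (2 : ℝ) • (S * I * dI) := by
    simp only [two_smul]
    noncomm_ring
  have h2 := key h Γ
  have h3 := key h.swap (Γ + H)
  rw [← hI] at h2
  rw [← hJ] at h3
  simp only [neg_mul, map_neg, mul_add, map_add] at h3
  rw [← map_sub, h1, map_sub, map_smul, map_smul, smul_eq_mul, smul_eq_mul, h2]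
  linarith

/-- The connection form on the canonical bundle in terms of the torsion. -/
theorem trace_canonical (h : IsPair g I J S) {Γ H dI dJ : E →L[ℝ] E} (hI : dI = I * Γ - Γ * I)
    (hJ : dJ = J * (Γ + H) - (Γ + H) * J) :
    traceCLM E (I * S * (dI * J + I * dJ - (dJ * I + J * dI))) - 2 * traceCLM E (I * Γ)
      = 4 * traceCLM E (S * J * H) := by
  set X := J * H - H * J with hX
  have hK := commutator_leibniz hI hJ
  rw [← hX] at hK
  have h1 : I * S * ((I * J - J * I) * Γ) = I * Γ := by
    rw [mul_assoc, ← mul_assoc S, h.inv_mul, one_mul]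
  have h2 : traceCLM E (I * S * (Γ * (I * J - J * I))) = -traceCLM E (I * Γ) := by
    rw [← mul_assoc, traceCLM_mul_comm, h.mul_left_eq, neg_mul, mul_neg, ← mul_assoc, ← mul_assoc,
      h.mul_inv, one_mul, map_neg]
  have h3 : I * S * (I * X) = S * X := by
    rw [h.mul_left_eq, neg_mul, mul_assoc, ← mul_assoc I, h.sq_left]; noncomm_ring
  have h4 : traceCLM E (I * S * (X * I)) = -traceCLM E (S * X) := by
    rw [← mul_assoc, traceCLM_mul_comm, ← mul_assoc, ← mul_assoc, h.sq_left]
    simp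
  have h5 : traceCLM E (S * X) = 2 * traceCLM E (S * J * H) := by
    rw [hX, mul_sub, ← mul_assoc, ← mul_assoc, map_sub, h.trace_mul_right]
    ring
  rw [hK, mul_add, mul_sub (I * S) ((I * J - J * I) * Γ), mul_sub (I * S) (I * X), map_add,
    map_sub, map_sub, h1, h2, h3, h4, h5]
  ring

/-- A trace form of the vanishing of the `(3, 0) + (0, 3)` component of the torsion: `S` has type
`(2, 0) + (0, 2)`. -/
theorem trace_type (h : IsPair g I J S) {H H' : E →L[ℝ] E}
    (hH : H = -(J * H * J) - J * H' + H' * J) :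
    traceCLM E (S * J * H) = traceCLM E (S * H') := by
  have h1 : S * J * H = S * H * J + S * H' + S * (J * H') * J := by
    conv_lhs => rw [hH]
    have h2 : S * J * (-(J * H * J) - J * H' + H' * J)
        = -(S * (J * J) * H * J) - S * (J * J) * H' + S * (J * H') * J := by noncomm_ring
    rw [h2, h.sq_right]
    noncomm_ring
  have h3 : S * J * (J * H') = -(S * H') := by
    rw [mul_assoc, ← mul_assoc J, h.sq_right]; noncomm_ring
  have h4 := congrArg (traceCLM E) h1
  rw [map_add, map_add, h.trace_mul_right, h.trace_mul_right, h3, map_neg] at h4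
  linarith

end IsPair

/-- The quadratic terms in the curvature of the connection form on the canonical bundle. Here `Γᵢ`
are values of the Bismut connection form, `Pᵢ` their conjugates by `[I, J]`, and `Γᵢ - Pᵢ + Qᵢ` the
logarithmic derivatives of `[I, J]`. -/
theorem trace_flat_aux {I Γ₁ Γ₂ P₁ P₂ Q₁ Q₂ : E →L[ℝ] E} (h₁ : Q₁ * I = I * Q₁)
    (h₂ : Q₂ * I = I * Q₂) (h₁₂ : traceCLM E (I * (P₁ * P₂)) = -traceCLM E (I * (Γ₁ * Γ₂)))
    (h₂₁ : traceCLM E (I * (P₂ * P₁)) = -traceCLM E (I * (Γ₂ * Γ₁))) :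
    traceCLM E ((I * Γ₁ - Γ₁ * I) * (Γ₂ - P₂ + Q₂))
      - traceCLM E (I * ((Γ₁ - P₁ + Q₁) * (Γ₂ - P₂ + Q₂)))
      - (traceCLM E ((I * Γ₂ - Γ₂ * I) * (Γ₁ - P₁ + Q₁))
      - traceCLM E (I * ((Γ₂ - P₂ + Q₂) * (Γ₁ - P₁ + Q₁))))
      = 2 * (traceCLM E (I * (Γ₁ * Γ₂)) - traceCLM E (I * (Γ₂ * Γ₁))) := by
  have hc : ∀ A B : E →L[ℝ] E, traceCLM E (A * (I * B)) = traceCLM E (I * (B * A)) := fun A B ↦ by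
    rw [traceCLM_mul_comm, mul_assoc]
  have hq : ∀ A Q : E →L[ℝ] E, Q * I = I * Q →
      traceCLM E (I * (Q * A)) = traceCLM E (I * (A * Q)) := fun A Q hQ ↦ by
    rw [← hc A Q, ← hQ, ← mul_assoc, traceCLM_mul_comm]
  have q1 := hq Γ₂ Q₁ h₁
  have q2 := hq P₂ Q₁ h₁
  have q3 := hq Q₂ Q₁ h₁
  have q4 := hq Γ₁ Q₂ h₂
  have q5 := hq P₁ Q₂ h₂
  simp only [mul_add, mul_sub, add_mul, sub_mul, map_add, map_sub, mul_assoc, hc]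
  linarith

end TraceIdentities

/-! ### Product rules for fields of endomorphisms -/

section ProductRules

variable {E : Type*} [NormedAddCommGroup E] [NormedSpace ℝ E] {y : E}

theorem fderiv_mul_clm {A B : E → E →L[ℝ] E} (hA : DifferentiableAt ℝ A y)
    (hB : DifferentiableAt ℝ B y) (v : E) :
    fderiv ℝ (fun z ↦ A z * B z) y v = fderiv ℝ A y v * B y + A y * fderiv ℝ B y v := by
  have h : HasFDerivAt (fun z ↦ A z * B z) _ y := hA.hasFDerivAt.mul' hB.hasFDerivAt
  rw [h.fderiv]
  simp [add_comm]

theorem fderiv_apply_const {F : Type*} [NormedAddCommGroup F] [NormedSpace ℝ F]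
    {A : E → E →L[ℝ] F} (hA : DifferentiableAt ℝ A y) (v w : E) :
    fderiv ℝ (fun z ↦ A z w) y v = fderiv ℝ A y v w := by
  rw [(hA.hasFDerivAt.clm_apply (hasFDerivAt_const w y)).fderiv]
  simp

theorem fderiv_traceCLM_apply [FiniteDimensional ℝ E] {A : E → E →L[ℝ] E}
    (hA : DifferentiableAt ℝ A y) (v : E) :
    fderiv ℝ (fun z ↦ traceCLM E (A z)) y v = traceCLM E (fderiv ℝ A y v) := by
  have h : HasFDerivAt (fun z ↦ traceCLM E (A z)) _ y :=
    (traceCLM E).hasFDerivAt.comp y hA.hasFDerivAt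
  rw [h.fderiv]
  rfl

end ProductRules

/-! ### The Bismut-Ricci form in a chart -/

section LocalGenKahler

variable {E : Type*} [NormedAddCommGroup E] [NormedSpace ℝ E]

/-- A nondegenerate generalized Kähler structure on the open subset `U` of the model space. -/
structure IsLocalGenKahler (U : Set E) (g : E → E →L[ℝ] E →L[ℝ] ℝ) (I J : E → E →L[ℝ] E) :
    Prop where
  left : IsLocalHermitian U g I
  right : IsLocalHermitian U g J
  torsion : ∀ y ∈ U, dcOmega g I y = -dcOmega g J y
  nondegenerate : ∀ y ∈ U, ∃ S, IsPair (g y) (I y) (J y) S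

/-- The function `½ log (det (I - J) / det (I + J))`, which turns out to be the Ricci potential. -/
def logDetRatio (I J : E →L[ℝ] E) : ℝ :=
  (1 / 2) * Real.log (LinearMap.det (I - J).toLinearMap / LinearMap.det (I + J).toLinearMap)

/-- The symmetry is due to the even dimension of `E`, which follows from `I² = -1`. -/
theorem logDetRatio_comm {I J : E →L[ℝ] E} (hI : I * I = -1) :
    logDetRatio J I = logDetRatio I J := by
  have h1 : LinearMap.det (-1 : E →L[ℝ] E).toLinearMap = 1 := by
    have h2 := det_mul_clm I I
    have h3 := det_mul_clm (-1 : E →L[ℝ] E) (-1)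
    rw [hI] at h2
    have h4 : LinearMap.det (-1 * -1 : E →L[ℝ] E).toLinearMap = 1 := by
      rw [neg_one_mul, neg_neg]; exact LinearMap.det_id
    rw [h4] at h3
    -- `det (-1) = (det I)²` is nonnegative, and its square is `1`
    nlinarith [mul_self_nonneg (LinearMap.det I.toLinearMap)]
  have h2 : J - I = -1 * (I - J) := by noncomm_ring
  rw [logDetRatio, logDetRatio, h2, det_mul_clm, h1, one_mul, add_comm]

/-- The inverse of the commutator `[I, J]`. -/
def commutatorInv (I J : E → E →L[ℝ] E) (y : E) : E →L[ℝ] E :=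
  ContinuousLinearMap.inverse (I y * J y - J y * I y)

namespace IsLocalGenKahler

variable {U : Set E} {g : E → E →L[ℝ] E →L[ℝ] ℝ} {I J : E → E →L[ℝ] E} {y : E}

theorem isPair (h : IsLocalGenKahler U g I J) (hy : y ∈ U) :
    IsPair (g y) (I y) (J y) (commutatorInv I J y) := by
  obtain ⟨S, hS⟩ := h.nondegenerate y hy
  rwa [commutatorInv, ContinuousLinearMap.inverse_eq hS.mul_inv hS.inv_mul]

theorem swap (h : IsLocalGenKahler U g I J) : IsLocalGenKahler U g J I where
  left := h.right
  right := h.left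
  torsion := fun y hy ↦ by rw [h.torsion y hy, neg_neg]
  nondegenerate := fun y hy ↦ ⟨_, (h.isPair hy).swap⟩

theorem fderiv_commutator (h : IsLocalGenKahler U g I J) (hy : y ∈ U) (v : E) :
    fderiv ℝ (fun z ↦ I z * J z - J z * I z) y v
      = fderiv ℝ I y v * J y + I y * fderiv ℝ J y v
        - (fderiv ℝ J y v * I y + J y * fderiv ℝ I y v) := by
  have h1 := (h.left.differentiableAt hy).hasFDerivAt
  have h2 := (h.right.differentiableAt hy).hasFDerivAt
  have h3 : HasFDerivAt (fun z ↦ I z * J z - J z * I z) _ y := (h1.mul' h2).sub (h2.mul' h1)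
  rw [h3.fderiv]
  simp [add_comm]

variable [FiniteDimensional ℝ E]

theorem contDiffOn_commutatorInv (h : IsLocalGenKahler U g I J) :
    ContDiffOn ℝ ∞ (commutatorInv I J) U := by
  intro z hz
  have hp := h.isPair hz
  have h1 : ContDiffAt ℝ ∞ (ContinuousLinearMap.inverse : (E →L[ℝ] E) → E →L[ℝ] E)
      (I z * J z - J z * I z) := by
    have : CompleteSpace E := FiniteDimensional.complete ℝ E
    exact contDiffAt_map_inverse
      (ContinuousLinearEquiv.equivOfInverse' _ _ hp.mul_inv hp.inv_mul)
  have h2 := h.left.contDiffAt hz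
  have h3 := h.right.contDiffAt hz
  exact (h1.comp z ((h2.mul h3).sub (h3.mul h2))).contDiffWithinAt

theorem fderiv_commutatorInv (h : IsLocalGenKahler U g I J) (hy : y ∈ U) (v : E) :
    fderiv ℝ (commutatorInv I J) y v
      = -(commutatorInv I J y * fderiv ℝ (fun z ↦ I z * J z - J z * I z) y v
        * commutatorInv I J y) := by
  have hU := h.left.mem_nhds hy
  have h1 := ((h.contDiffOn_commutatorInv.contDiffAt hU).differentiableAt (by simp)).hasFDerivAt
  have h2 : DifferentiableAt ℝ (fun z ↦ I z * J z - J z * I z) y := by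
    have hI := h.left.differentiableAt hy
    have hJ := h.right.differentiableAt hy
    exact (hI.mul hJ).sub (hJ.mul hI)
  have h3 := (h1.mul' h2.hasFDerivAt).congr_of_eventuallyEq (f₁ := fun _ ↦ 1)
    (Filter.eventually_of_mem hU fun z hz ↦ ((h.isPair hz).inv_mul).symm)
  have h4 := congrArg (fun T : E →L[ℝ] (E →L[ℝ] E) ↦ T v) (h3.unique (hasFDerivAt_const _ y))
  simp at h4
  have h5 := congrArg (· * commutatorInv I J y) h4
  simp only [add_mul, zero_mul] at h5
  rw [mul_assoc (fderiv ℝ (commutatorInv I J) y v), (h.isPair hy).mul_inv, mul_one] at h5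
  exact eq_neg_of_add_eq_zero_right h5

theorem contDiffOn_logDetRatio (h : IsLocalGenKahler U g I J) :
    ContDiffOn ℝ ∞ (fun z ↦ logDetRatio (I z) (J z)) U := by
  intro z hz
  have hp := h.isPair hz
  have h1 : ContDiffAt ℝ ∞ (fun z ↦ LinearMap.det (I z - J z).toLinearMap) z :=
    contDiff_det.contDiffAt.comp z ((h.left.contDiffAt hz).sub (h.right.contDiffAt hz))
  have h2 : ContDiffAt ℝ ∞ (fun z ↦ LinearMap.det (I z + J z).toLinearMap) z :=
    contDiff_det.contDiffAt.comp z ((h.left.contDiffAt hz).add (h.right.contDiffAt hz))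
  have h3 := (h1.div h2 (det_ne_zero_of_mul_eq_one hp.mul_inv_add)).log hp.det_ratio_pos.ne'
  exact (contDiffAt_const.mul h3).contDiffWithinAt

/-- `J` is parallel for the Bismut connection of `J`, written as the one of `I` plus the
difference. -/
theorem fderiv_right (h : IsLocalGenKahler U g I J) (hy : y ∈ U) (v : E) :
    fderiv ℝ J y v = J y * (bismutForm g I y v + (bismutForm g J y v - bismutForm g I y v))
      - (bismutForm g I y v + (bismutForm g J y v - bismutForm g I y v)) * J y := by
  rw [add_sub_cancel, h.right.fderiv_eq_commutator (h.left.isInvertible hy) hy]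

theorem fderiv_logDetRatio (h : IsLocalGenKahler U g I J) (hy : y ∈ U) (v : E) :
    fderiv ℝ (fun z ↦ logDetRatio (I z) (J z)) y v
      = -2 * traceCLM E (commutatorInv I J y * (bismutForm g J y v - bismutForm g I y v)) := by
  have hp := h.isPair hy
  have h1 := (h.left.differentiableAt hy).hasFDerivAt
  have h2 := (h.right.differentiableAt hy).hasFDerivAt
  have hdet : ∀ A : E →L[ℝ] E, HasFDerivAt (fun A : E →L[ℝ] E ↦ LinearMap.det A.toLinearMap)
      (fderiv ℝ (fun A : E →L[ℝ] E ↦ LinearMap.det A.toLinearMap) A) A := fun A ↦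
    (contDiff_det.differentiable (by simp) A).hasFDerivAt
  have d1 := (hdet (I y - J y)).comp y (h1.sub h2)
  have d2 := (hdet (I y + J y)).comp y (h1.add h2)
  have n1 := det_ne_zero_of_mul_eq_one hp.mul_inv_sub
  have n2 := det_ne_zero_of_mul_eq_one hp.mul_inv_add
  have h3 := ((d1.log n1).sub (d2.log n2)).const_mul (1 / 2)
  have h4 := h3.congr_of_eventuallyEq (f₁ := fun z ↦ logDetRatio (I z) (J z))
    (Filter.eventually_of_mem (h.left.mem_nhds hy) fun z hz ↦ by
      have hz' := h.isPair hz
      have m1 := det_ne_zero_of_mul_eq_one hz'.mul_inv_sub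
      have m2 := det_ne_zero_of_mul_eq_one hz'.mul_inv_add
      simp only [logDetRatio, Real.log_div m1 m2]
      rfl)
  rw [h4.fderiv, ← hp.trace_log_deriv (h.left.fderiv_eq_commutator (h.left.isInvertible hy) hy v)
    (h.fderiv_right hy v)]
  simp only [smul_apply, sub_apply, ContinuousLinearMap.comp_apply, add_apply, smul_eq_mul,
    Function.comp_apply, Pi.sub_apply, Pi.add_apply,
    fderiv_det hp.mul_inv_sub, fderiv_det hp.mul_inv_add]
  rw [inv_mul_cancel_left₀ n1, inv_mul_cancel_left₀ n2]

/-- The difference of the two Bismut connections is the torsion 3-form, as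
`d^c_I ω_I = -d^c_J ω_J`. -/
theorem torsion_inner (h : IsLocalGenKahler U g I J) (hy : y ∈ U) (v w u : E) :
    g y ((bismutForm g J y v - bismutForm g I y v) w) u = -dcOmega g J y ![v, w, u] := by
  have hg := h.left.isInvertible hy
  rw [sub_apply, map_sub, sub_apply, bismutForm_inner _ _ _ _ _ _ hg,
    bismutForm_inner _ _ _ _ _ _ hg, h.torsion y hy, ContinuousAlternatingMap.neg_apply]
  ring

/-- The torsion has type `(2, 1) + (1, 2)` for `J`, and `S` has type `(2, 0) + (0, 2)`; hence the
trace of `S J` with the torsion in direction `v` is that of `S` with the torsion in direction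
`J v`. -/
theorem trace_torsion (h : IsLocalGenKahler U g I J) (hy : y ∈ U) (v : E) :
    traceCLM E (commutatorInv I J y * J y * (bismutForm g J y v - bismutForm g I y v))
      = traceCLM E (commutatorInv I J y *
        (bismutForm g J y (J y v) - bismutForm g I y (J y v))) := by
  refine (h.isPair hy).trace_type ?_
  have h1 : ∀ a b, g y (J y a) b = -g y a (J y b) := h.right.skew y hy
  have h3 := h.torsion_inner hy
  obtain ⟨T, hT⟩ : ∃ T : E → E →L[ℝ] E, ∀ v, bismutForm g J y v - bismutForm g I y v = T v :=
    ⟨_, fun _ ↦ rfl⟩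
  simp only [hT] at h3 ⊢
  ext w
  refine (h.left.isInvertible hy).injective ?_
  ext u
  have h2 := h.right.dcOmega_type hy v w u
  simp only [add_apply, neg_apply, mul_clm_apply, map_add, map_sub, map_neg, sub_apply, h1, h3]
  linarith

/-- The rotated differential `J dΦ` as a trace of the connection form of the Bismut connection of
`I` and of the derivative of `[I, J]`. The term `tr (I Γ)` is a connection form on the canonical
bundle of `I`, and the derivative of `[I, J]` is what makes the sum independent of the frame. -/
theorem two_mul_rotate_fderiv (h : IsLocalGenKahler U g I J) (hy : y ∈ U) (w : E) :
    2 * rotate (J y) (fderiv ℝ (fun z ↦ logDetRatio (I z) (J z)) y) w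
      = traceCLM E (I y * commutatorInv I J y * fderiv ℝ (fun z ↦ I z * J z - J z * I z) y w)
        - 2 * traceCLM E (I y * bismutForm g I y w) := by
  rw [h.fderiv_commutator hy, (h.isPair hy).trace_canonical
    (h.left.fderiv_eq_commutator (h.left.isInvertible hy) hy w) (h.fderiv_right hy w),
    h.trace_torsion hy, rotate, neg_apply, ContinuousLinearMap.comp_apply, h.fderiv_logDetRatio hy]
  ring

/-- The Bismut-Ricci form is exact with primitive `-½ J dΦ`: the exterior derivative of the
expression for `J dΦ` in `two_mul_rotate_fderiv` is computed with `trace_flat_aux`. -/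
theorem bismutRicci_eq (h : IsLocalGenKahler U g I J) (hy : y ∈ U) (v w : E) :
    bismutRicci g I y v w
      = -(1 / 2) * dId J (fun z ↦ logDetRatio (I z) (J z)) y ![v, w] := by
  have hU := h.left.mem_nhds hy
  set Φ : E → ℝ := fun z ↦ logDetRatio (I z) (J z) with hΦ
  set K : E → E →L[ℝ] E := fun z ↦ I z * J z - J z * I z with hK
  set S := commutatorInv I J with hS
  set Γ := bismutForm g I with hΓ
  have hp := h.isPair hy
  have hI := h.left.differentiableAt hy
  have hJ := h.right.differentiableAt hy
  have hΦd : DifferentiableAt ℝ (fderiv ℝ Φ) y :=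
    ((h.contDiffOn_logDetRatio.contDiffAt hU).fderiv_right (m := ∞) (by simp)).differentiableAt
      (by simp)
  have hKc : ContDiffAt ℝ ∞ K y := by
    have h2 := h.left.contDiffAt hy
    have h3 := h.right.contDiffAt hy
    exact (h2.mul h3).sub (h3.mul h2)
  have hKd : DifferentiableAt ℝ (fderiv ℝ K) y :=
    (hKc.fderiv_right (m := ∞) (by simp)).differentiableAt (by simp)
  have hSd : DifferentiableAt ℝ S y :=
    (h.contDiffOn_commutatorInv.contDiffAt hU).differentiableAt (by simp)
  have hΓd : DifferentiableAt ℝ Γ y :=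
    (h.left.contDiffOn_bismutForm.contDiffAt hU).differentiableAt (by simp)
  have hβd : DifferentiableAt ℝ (fun z ↦ rotate (J z) (fderiv ℝ Φ z)) y :=
    (hΦd.clm_comp hJ).neg
  -- The derivative of the connection form.
  have key : ∀ v w, 2 * fderiv ℝ (fun z ↦ rotate (J z) (fderiv ℝ Φ z)) y v w
      = traceCLM E ((fderiv ℝ I y v * S y - I y * (S y * fderiv ℝ K y v * S y)) * fderiv ℝ K y w
          + I y * S y * fderiv ℝ (fderiv ℝ K) y v w)
        - 2 * traceCLM E (fderiv ℝ I y v * Γ y w + I y * fderiv ℝ Γ y v w) := by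
    intro v w
    have hK' : DifferentiableAt ℝ (fun z ↦ fderiv ℝ K z w) y :=
      hKd.clm_apply (differentiableAt_const w)
    have hΓ' : DifferentiableAt ℝ (fun z ↦ Γ z w) y := hΓd.clm_apply (differentiableAt_const w)
    have e1 : (fun z ↦ 2 * rotate (J z) (fderiv ℝ Φ z) w) =ᶠ[nhds y] fun z ↦
        traceCLM E (I z * S z * fderiv ℝ K z w) - 2 * traceCLM E (I z * Γ z w) :=
      Filter.eventually_of_mem hU fun z hz ↦ h.two_mul_rotate_fderiv hz w
    have e2 := congrArg (fun T : E →L[ℝ] ℝ ↦ T v) e1.fderiv_eq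
    have d1 : DifferentiableAt ℝ (fun z ↦ I z * S z) y := hI.mul hSd
    have d2 : DifferentiableAt ℝ (fun z ↦ I z * S z * fderiv ℝ K z w) y := d1.mul hK'
    have d3 : DifferentiableAt ℝ (fun z ↦ I z * Γ z w) y := hI.mul hΓ'
    have d4 : DifferentiableAt ℝ (fun z ↦ traceCLM E (I z * S z * fderiv ℝ K z w)) y :=
      (traceCLM E).differentiableAt.comp y d2
    have d5 : DifferentiableAt ℝ (fun z ↦ traceCLM E (I z * Γ z w)) y :=
      (traceCLM E).differentiableAt.comp y d3
    rw [fderiv_fun_sub d4 (d5.const_mul 2), fderiv_const_mul d5,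
      fderiv_const_mul (hβd.clm_apply (differentiableAt_const w)), sub_apply, smul_apply,
      smul_apply, fderiv_traceCLM_apply d2, fderiv_traceCLM_apply d3, fderiv_mul_clm d1 hK',
      fderiv_mul_clm hI hΓ', fderiv_mul_clm hI hSd, fderiv_apply_const hβd,
      fderiv_apply_const hKd, fderiv_apply_const hΓd, h.fderiv_commutatorInv hy] at e2
    rw [← smul_eq_mul, e2, mul_neg, ← sub_eq_add_neg, smul_eq_mul]
  have hsym : fderiv ℝ (fderiv ℝ K) y v w = fderiv ℝ (fderiv ℝ K) y w v :=
    hKc.isSymmSndFDerivAt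
      (by
        rw [minSmoothness_of_isRCLikeNormedField]
        exact WithTop.coe_le_coe.mpr (le_top (a := (2 : ℕ∞)))) v w
  have hdI := h.left.fderiv_eq_commutator (h.left.isInvertible hy) hy
  -- `[I, J]` is parallel up to an endomorphism which anticommutes with `I`.
  have hP : ∀ x, ∃ Q, Q * I y = I y * Q ∧ S y * fderiv ℝ K y x
      = Γ y x - S y * Γ y x * K y + Q := by
    intro x
    set X := J y * (bismutForm g J y x - bismutForm g I y x)
      - (bismutForm g J y x - bismutForm g I y x) * J y
    refine ⟨S y * (I y * X - X * I y), ?_, ?_⟩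
    · have hq := h.left.sq y hy
      have h1 : S y * (I y * X - X * I y) * I y = S y * (I y * X * I y + X) := by
        rw [mul_assoc (S y), sub_mul, mul_assoc X, hq]; noncomm_ring
      have h2 : I y * (S y * (I y * X - X * I y)) = S y * (I y * X * I y + X) := by
        rw [← mul_assoc, hp.mul_left_eq, neg_mul, mul_assoc, mul_sub, ← mul_assoc (I y) (I y), hq]
        noncomm_ring
      rw [h1, h2]
    · rw [h.fderiv_commutator hy, commutator_leibniz (hdI x) (h.fderiv_right hy x), mul_add,
        mul_sub, ← mul_assoc, hp.inv_mul, one_mul, ← mul_assoc]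
  obtain ⟨Q₁, hQ₁, hP₁⟩ := hP v
  obtain ⟨Q₂, hQ₂, hP₂⟩ := hP w
  have hconj : ∀ A B : E →L[ℝ] E, traceCLM E (I y * ((S y * A * K y) * (S y * B * K y)))
      = -traceCLM E (I y * (A * B)) := by
    intro A B
    have h1 : I y * ((S y * A * K y) * (S y * B * K y)) = I y * S y * A * B * K y := by
      have : (S y * A * K y) * (S y * B * K y) = S y * A * (K y * S y) * B * K y := by noncomm_ring
      rw [this, hp.mul_inv, mul_one]
      noncomm_ring
    rw [h1, traceCLM_mul_comm, hp.mul_left_eq]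
    have h2 : K y * (-(S y * I y) * A * B) = -((K y * S y) * (I y * (A * B))) := by noncomm_ring
    rw [h2, hp.mul_inv, one_mul, map_neg]
  have hflat := trace_flat_aux hQ₁ hQ₂ (hconj (Γ y v) (Γ y w)) (hconj (Γ y w) (Γ y v))
  rw [← hP₁, ← hP₂, ← hdI, ← hdI] at hflat
  have k1 := key v w
  have k2 := key w v
  have hc : ∀ A B : E →L[ℝ] E, traceCLM E (A * I y * B) = traceCLM E (I y * (B * A)) := fun A B ↦ by
    rw [mul_assoc, traceCLM_mul_comm, mul_assoc]
  have hm : ∀ A B C : E →L[ℝ] E, (A * S y - I y * (S y * B * S y)) * C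
      = A * (S y * C) - I y * (S y * B * (S y * C)) := fun A B C ↦ by noncomm_ring
  have hβ : dId J Φ y ![v, w] = fderiv ℝ (fun z ↦ rotate (J z) (fderiv ℝ Φ z)) y v w
      - fderiv ℝ (fun z ↦ rotate (J z) (fderiv ℝ Φ z)) y w v := extDeriv_one_apply hβd v w
  have hρ : bismutRicci g I y v w = (1 / 2) * traceCLM E ((fderiv ℝ Γ y v w - fderiv ℝ Γ y w v
      + (Γ y v * Γ y w - Γ y w * Γ y v)) * I y) := rfl
  have hG : ∀ A B : E →L[ℝ] E, traceCLM E ((I y * A - A * I y) * B)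
      = traceCLM E (I y * (A * B)) - traceCLM E (I y * (B * A)) := fun A B ↦ by
    rw [sub_mul, map_sub, hc, mul_assoc]
  rw [hβ, hρ, traceCLM_mul_comm]
  simp only [hm, map_add, map_sub, mul_add, mul_sub, hsym, hdI, hG] at k1 k2 hflat ⊢
  linarith

end IsLocalGenKahler
end LocalGenKahler

/-! ### Coordinate frames -/

section ChartFrames

variable {E : Type*} [NormedAddCommGroup E] [NormedSpace ℝ E]

theorem dId_congr {I : E → E →L[ℝ] E} {f₁ f₂ : E → ℝ} {y : E} (hf : f₁ =ᶠ[nhds y] f₂) :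
    dId I f₁ y = dId I f₂ y := by
  refine Filter.EventuallyEq.extDeriv_eq ?_
  have h1 : fderiv ℝ f₁ =ᶠ[nhds y] fderiv ℝ f₂ := hf.fderiv
  filter_upwards [h1] with z hz
  rw [hz]

variable {M : Type*} [TopologicalSpace M] [ChartedSpace E M] {e : OpenPartialHomeomorph M E}

/-- The coordinate vector fields of the chart `e`, as a map from the model space. -/
def frame (e : OpenPartialHomeomorph M E) (y : E) : E →L[ℝ] E :=
  mfderiv 𝓘(ℝ, E) 𝓘(ℝ, E) e.symm y

/-- The differentials of the coordinates of the chart `e`, as a map to the model space. -/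
def coframe (e : OpenPartialHomeomorph M E) (y : E) : E →L[ℝ] E :=
  mfderiv 𝓘(ℝ, E) 𝓘(ℝ, E) e (e.symm y)

/-- The endomorphism field `A` at the point `x`, as an endomorphism of the model space, of which the
tangent space is a synonym. -/
def endAt (A : EndField E M) (x : M) : E →L[ℝ] E := A x

theorem endIn_eq (A : EndField E M) (y : E) :
    endIn A e y = coframe e y * (endAt A (e.symm y) * frame e y) := rfl

end ChartFrames

/-! ### Tensor fields in a chart -/

section Charts

variable {E : Type*} [NormedAddCommGroup E] [NormedSpace ℝ E]
  {M : Type*} [TopologicalSpace M] [ChartedSpace E M] [IsManifold 𝓘(ℝ, E) ∞ M]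
  {e : OpenPartialHomeomorph M E}

/-- Constant vector fields in a chart are smooth vector fields on the manifold. -/
theorem contMDiffOn_mfderiv_symm (he : e ∈ atlas E M) (v : E) :
    ContMDiffOn 𝓘(ℝ, E) 𝓘(ℝ, E).tangent ∞ (fun y : E ↦ Bundle.TotalSpace.mk' E
      (E := fun x : M ↦ TangentSpace 𝓘(ℝ, E) x) (e.symm y)
      (mfderiv 𝓘(ℝ, E) 𝓘(ℝ, E) e.symm y v)) e.target := by
  have : IsManifold 𝓘(ℝ, E) 1 M := IsManifold.of_le (n := ∞) (by simp)
  have h1 := contMDiffOn_symm_of_mem_maximalAtlas (I := 𝓘(ℝ, E)) (n := ∞)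
    (StructureGroupoid.subset_maximalAtlas _ he)
  have h2 := h1.contMDiffOn_tangentMapWithin (m := ∞) (by simp) e.open_target.uniqueMDiffOn
  have h3 : ContMDiff 𝓘(ℝ, E) 𝓘(ℝ, E).tangent ∞
      (fun y : E ↦ Bundle.TotalSpace.mk' E (E := fun x : E ↦ TangentSpace 𝓘(ℝ, E) x) y v) :=
    contMDiff_vectorSpace_iff_contDiff.mpr contDiff_const
  refine (h2.comp (h3.contMDiffOn (s := e.target)) fun y hy ↦ hy).congr fun y hy ↦ ?_
  simp only [Function.comp_apply, tangentMapWithin, mfderivWithin_of_isOpen e.open_target hy]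

/-- Smooth vector fields have smooth components in a chart. -/
theorem contDiffOn_mfderiv (he : e ∈ atlas E M) {V : ∀ y : E, TangentSpace 𝓘(ℝ, E) (e.symm y)}
    (hV : ContMDiffOn 𝓘(ℝ, E) 𝓘(ℝ, E).tangent ∞ (fun y : E ↦ Bundle.TotalSpace.mk' E
      (E := fun x : M ↦ TangentSpace 𝓘(ℝ, E) x) (e.symm y) (V y)) e.target) :
    ContDiffOn ℝ ∞ (fun y ↦ (mfderiv 𝓘(ℝ, E) 𝓘(ℝ, E) e (e.symm y) (V y) : E)) e.target := by
  have : IsManifold 𝓘(ℝ, E) 1 M := IsManifold.of_le (n := ∞) (by simp)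
  have h1 := contMDiffOn_of_mem_maximalAtlas (I := 𝓘(ℝ, E)) (n := ∞)
    (StructureGroupoid.subset_maximalAtlas _ he)
  have h2 := h1.contMDiffOn_tangentMapWithin (m := ∞) (by simp) e.open_source.uniqueMDiffOn
  have h3 := h2.comp hV fun y hy ↦ e.map_target hy
  have h4 : ContMDiffOn 𝓘(ℝ, E) 𝓘(ℝ, E) ∞
      (fun y ↦ (mfderiv 𝓘(ℝ, E) 𝓘(ℝ, E) e (e.symm y) (V y) : E)) e.target := by
    refine ((contMDiff_snd_tangentBundle_modelSpace E 𝓘(ℝ, E)).comp_contMDiffOn h3).congr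
      fun y hy ↦ ?_
    exact congrArg (fun D : E →L[ℝ] E ↦ D (V y))
      (mfderivWithin_of_isOpen e.open_source (e.map_target hy)).symm
  exact h4.contDiffOn

theorem coframe_mul_frame (he : e ∈ atlas E M) {y : E} (hy : y ∈ e.target) :
    coframe e y * frame e y = 1 := by
  have : IsManifold 𝓘(ℝ, E) 1 M := IsManifold.of_le (n := ∞) (by simp)
  exact (mdifferentiable_of_mem_atlas (I := 𝓘(ℝ, E)) he).comp_symm_deriv hy

/-- The metric at the point `x`, as a bilinear form on the model space. -/
def metricAt (g : Metric E M) (x : M) : E →L[ℝ] E →L[ℝ] ℝ := g.inner x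

theorem metricAt_symm (g : Metric E M) (x : M) (v w : E) :
    metricAt g x v w = metricAt g x w v := g.symm x v w

theorem metricAt_pos (g : Metric E M) (x : M) {v : E} (hv : v ≠ 0) : 0 < metricAt g x v v :=
  g.pos x v hv

theorem metricIn_apply (g : Metric E M) (y v w : E) :
    metricIn g e y v w = metricAt g (e.symm y) (frame e y v) (frame e y w) := rfl

theorem metricIn_pos (g : Metric E M) (he : e ∈ atlas E M) {y : E} (hy : y ∈ e.target) {v : E}
    (hv : v ≠ 0) : 0 < metricIn g e y v v := by
  rw [metricIn_apply]
  refine metricAt_pos g _ fun h0 ↦ hv ?_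
  have h1 := congrArg (fun B : E →L[ℝ] E ↦ B v) (coframe_mul_frame he hy)
  rw [mul_clm_apply, h0, map_zero] at h1
  exact h1.symm

theorem det_conj (he : e ∈ atlas E M) {y : E} (hy : y ∈ e.target) (A : E →L[ℝ] E) :
    LinearMap.det (coframe e y * (A * frame e y)).toLinearMap = LinearMap.det A.toLinearMap := by
  have h := congrArg (fun B : E →L[ℝ] E ↦ LinearMap.det B.toLinearMap) (coframe_mul_frame he hy)
  simp only [det_mul_clm] at h ⊢
  have h1 : LinearMap.det (1 : E →L[ℝ] E).toLinearMap = 1 := LinearMap.det_id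
  rw [h1] at h
  linear_combination (LinearMap.det A.toLinearMap) * h

/-- The determinants do not depend on the chart. -/
theorem logDetRatio_conj (he : e ∈ atlas E M) {y : E} (hy : y ∈ e.target) (A B : EndField E M) :
    logDetRatio (endIn A e y) (endIn B e y)
      = logDetRatio (endAt A (e.symm y)) (endAt B (e.symm y)) := by
  simp only [logDetRatio, endIn_eq, ← mul_add, ← mul_sub, ← add_mul, ← sub_mul, det_conj he hy]

namespace IsHermitian

variable {g : Metric E M} {I : EndField E M}

theorem endAt_sq (h : IsHermitian g I) (x : M) : endAt I x * endAt I x = -1 :=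
  ContinuousLinearMap.ext fun v ↦ h.sq x v

theorem endAt_skew (h : IsHermitian g I) (x : M) (v w : E) :
    metricAt g x (endAt I x v) w = -metricAt g x v (endAt I x w) := by
  have h1 : metricAt g x (endAt I x v) (endAt I x (endAt I x w)) = metricAt g x v (endAt I x w) :=
    h.compatible x v (endAt I x w)
  have h2 : endAt I x (endAt I x w) = -w := h.sq x w
  rw [h2, map_neg] at h1
  linarith

end IsHermitian

end Charts

/-! ### Generalized Kähler manifolds in a chart -/

section FiniteDimensionalCharts

variable {E : Type*} [NormedAddCommGroup E] [NormedSpace ℝ E] [FiniteDimensional ℝ E]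
  {M : Type*} [TopologicalSpace M] [ChartedSpace E M] [IsManifold 𝓘(ℝ, E) ∞ M]
  {e : OpenPartialHomeomorph M E}

theorem contDiffOn_metricIn (g : Metric E M) (he : e ∈ atlas E M) :
    ContDiffOn ℝ ∞ (metricIn g e) e.target := by
  refine contDiffOn_clm_apply.mpr fun v ↦ contDiffOn_clm_apply.mpr fun w ↦ ?_
  have hs := contMDiffOn_symm_of_mem_maximalAtlas (I := 𝓘(ℝ, E)) (n := ∞)
    (StructureGroupoid.subset_maximalAtlas _ he)
  have h1 : ContMDiffOn 𝓘(ℝ, E) (𝓘(ℝ, E).prod 𝓘(ℝ)) ∞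
      (fun y : E ↦ Bundle.TotalSpace.mk' ℝ (E := Bundle.Trivial M ℝ) (e.symm y)
        (g.inner (e.symm y) (mfderiv 𝓘(ℝ, E) 𝓘(ℝ, E) e.symm y v)
          (mfderiv 𝓘(ℝ, E) 𝓘(ℝ, E) e.symm y w))) e.target := by
    apply ContMDiffOn.clm_bundle_apply₂ (F₁ := E) (F₂ := E)
    · exact g.contMDiff.comp_contMDiffOn hs
    · exact contMDiffOn_mfderiv_symm he v
    · exact contMDiffOn_mfderiv_symm he w
  intro y hy
  have h2 := h1 y hy
  simp only [Bundle.contMDiffWithinAt_totalSpace] at h2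
  exact h2.2.contDiffWithinAt

theorem contDiffOn_endIn {A : EndField E M}
    (hA : ContMDiff 𝓘(ℝ, E) (𝓘(ℝ, E).prod 𝓘(ℝ, E →L[ℝ] E)) ∞
      (fun x ↦ Bundle.TotalSpace.mk' (E →L[ℝ] E)
        (E := fun x : M ↦ TangentSpace 𝓘(ℝ, E) x →L[ℝ] TangentSpace 𝓘(ℝ, E) x) x (A x)))
    (he : e ∈ atlas E M) : ContDiffOn ℝ ∞ (endIn A e) e.target := by
  refine contDiffOn_clm_apply.mpr fun v ↦ ?_
  have hs := contMDiffOn_symm_of_mem_maximalAtlas (I := 𝓘(ℝ, E)) (n := ∞)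
    (StructureGroupoid.subset_maximalAtlas _ he)
  have h1 : ContMDiffOn 𝓘(ℝ, E) 𝓘(ℝ, E).tangent ∞ (fun y : E ↦ Bundle.TotalSpace.mk' E
      (E := fun x : M ↦ TangentSpace 𝓘(ℝ, E) x) (e.symm y)
      (A (e.symm y) (mfderiv 𝓘(ℝ, E) 𝓘(ℝ, E) e.symm y v))) e.target := by
    apply ContMDiffOn.clm_bundle_apply (F₁ := E) (F₂ := E)
    · exact hA.comp_contMDiffOn hs
    · exact contMDiffOn_mfderiv_symm he v
  exact contDiffOn_mfderiv he h1

theorem frame_mul_coframe (he : e ∈ atlas E M) {y : E} (hy : y ∈ e.target) :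
    frame e y * coframe e y = 1 :=
  mul_clm_eq_one_symm (coframe_mul_frame he hy)

theorem frame_mul_endIn (A : EndField E M) (he : e ∈ atlas E M) {y : E} (hy : y ∈ e.target) :
    frame e y * endIn A e y = endAt A (e.symm y) * frame e y := by
  rw [endIn_eq, ← mul_assoc, frame_mul_coframe he hy, one_mul]

theorem conj_mul_conj (he : e ∈ atlas E M) {y : E} (hy : y ∈ e.target) (A B : E →L[ℝ] E) :
    coframe e y * (A * frame e y) * (coframe e y * (B * frame e y))
      = coframe e y * (A * B * frame e y) := by
  have h := frame_mul_coframe he hy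
  calc _ = coframe e y * (A * ((frame e y * coframe e y) * (B * frame e y))) := by
        noncomm_ring
    _ = _ := by rw [h, one_mul, mul_assoc]

namespace IsHermitian

variable {g : Metric E M} {I : EndField E M}

theorem isLocalHermitian (h : IsHermitian g I) (he : e ∈ atlas E M) :
    IsLocalHermitian e.target (metricIn g e) (endIn I e) where
  isOpen := e.open_target
  smooth_metric := contDiffOn_metricIn g he
  smooth := contDiffOn_endIn h.smooth he
  symm y _ v w := metricAt_symm g _ _ _
  pos y hy v hv := metricIn_pos g he hy hv
  sq y hy := by
    rw [endIn_eq, conj_mul_conj he hy, h.endAt_sq, neg_one_mul, mul_neg, coframe_mul_frame he hy]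
  skew y hy v w := by
    have h1 := fun v ↦ congrArg (fun B : E →L[ℝ] E ↦ B v) (frame_mul_endIn I he hy)
    simp only [mul_clm_apply] at h1
    rw [metricIn_apply, metricIn_apply, h1, h1, h.endAt_skew]
  integrable := h.integrable e he

end IsHermitian

namespace IsGeneralizedKahler

variable {g : Metric E M} {I J : EndField E M}

/-- The commutator of the complex structures is invertible where `σ` is nondegenerate. -/
theorem exists_isPair (h : IsGeneralizedKahler g I J) (hnd : IsNondegenerate g I J) (x : M) :
    ∃ S, IsPair (metricAt g x) (endAt I x) (endAt J x) S := by
  have hpos : ∀ v : E, v ≠ 0 → 0 < metricAt g x v v := fun v hv ↦ g.pos x v hv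
  have hg := isInvertible_of_pos hpos
  have hinj : Function.Injective
      (endAt I x * endAt J x - endAt J x * endAt I x).toLinearMap := by
    refine (injective_iff_map_eq_zero _).mpr fun v hv ↦ ?_
    have h1 : metricAt g x v = 0 := by
      refine hnd x (metricAt g x v) fun β ↦ ?_
      have h2 : ContinuousLinearMap.inverse (metricAt g x) (metricAt g x v) = v :=
        hg.inverse_apply_self v
      have h3 : poisson (metricAt g x) (endAt I x) (endAt J x) (metricAt g x v) = 0 := by
        rw [poisson, h2]
        exact hv
      exact (congrArg β h3).trans (map_zero β)
    by_contra h0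
    have h4 := hpos v h0
    rw [h1] at h4
    exact lt_irrefl _ h4
  obtain ⟨T, hT⟩ := (LinearMap.isUnit_iff_ker_eq_bot _).mpr (LinearMap.ker_eq_bot.mpr hinj)
  have hmul : (endAt I x * endAt J x - endAt J x * endAt I x)
      * LinearMap.toContinuousLinearMap (↑T⁻¹ : E →ₗ[ℝ] E) = 1 := by
    ext v
    have h5 := congrArg (fun A : E →ₗ[ℝ] E ↦ A v) T.mul_inv
    rw [hT] at h5
    exact h5
  exact ⟨_, metricAt_symm g x, hpos, h.hermitian_left.endAt_sq x, h.hermitian_right.endAt_sq x,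
    h.hermitian_left.endAt_skew x, h.hermitian_right.endAt_skew x, hmul,
    mul_clm_eq_one_symm hmul⟩

theorem isLocalGenKahler (h : IsGeneralizedKahler g I J) (hnd : IsNondegenerate g I J)
    (he : e ∈ atlas E M) :
    IsLocalGenKahler e.target (metricIn g e) (endIn I e) (endIn J e) where
  left := h.hermitian_left.isLocalHermitian he
  right := h.hermitian_right.isLocalHermitian he
  torsion := h.torsion e he
  nondegenerate y hy := by
    obtain ⟨S, hS⟩ := h.exists_isPair hnd (e.symm y)
    have hI := h.hermitian_left.isLocalHermitian he
    have hJ := h.hermitian_right.isLocalHermitian he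
    have hmul : (endIn I e y * endIn J e y - endIn J e y * endIn I e y)
        * (coframe e y * (S * frame e y)) = 1 := by
      simp only [endIn_eq, conj_mul_conj he hy, ← mul_sub, ← sub_mul, hS.mul_inv, one_mul,
        coframe_mul_frame he hy]
    exact ⟨_, hI.symm y hy, hI.pos y hy, hI.sq y hy, hJ.sq y hy, hI.skew y hy, hJ.skew y hy,
      hmul, mul_clm_eq_one_symm hmul⟩

theorem ricciPotential_eq (h : IsGeneralizedKahler g I J) (hnd : IsNondegenerate g I J)
    {n : ℕ} (hn : Module.finrank ℝ E = 4 * n) (x : M) :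
    ricciPotential g I J x = logDetRatio (endAt I x) (endAt J x) := by
  obtain ⟨S, hS⟩ := h.exists_isPair hnd x
  have h1 := hS.formRatio_pairing (m := 2 * n) (by omega)
  have h2 : ricciPotential g I J x = Real.log (formRatio (pairingPlus (metricAt g x) (endAt I x)
    (endAt J x)) (pairingMinus (metricAt g x) (endAt I x) (endAt J x))).re := rfl
  rw [h2, h1, Complex.ofReal_re, Real.log_sqrt hS.det_ratio_pos.le, logDetRatio]
  ring

theorem pairing_ne_zero_and_eq (h : IsGeneralizedKahler g I J) (hnd : IsNondegenerate g I J)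
    {n : ℕ} (hn : Module.finrank ℝ E = 4 * n) (x : M) :
    pairingMinusAt g I J x ≠ 0 ∧ pairingPlusAt g I J x
      = ((Real.exp (ricciPotential g I J x) : ℝ) : ℂ) • pairingMinusAt g I J x := by
  obtain ⟨S, hS⟩ := h.exists_isPair hnd x
  refine ⟨hS.pairingMinus_ne_zero (m := 2 * n) (by omega), ?_⟩
  have h1 := hS.pairingPlus_eq_smul (m := 2 * n) (by omega)
  have h2 : Real.exp (ricciPotential g I J x) = √(LinearMap.det (endAt I x - endAt J x).toLinearMap
      / LinearMap.det (endAt I x + endAt J x).toLinearMap) := by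
    rw [h.ricciPotential_eq hnd hn, logDetRatio, mul_comm, ← div_eq_mul_one_div,
      ← Real.log_sqrt hS.det_ratio_pos.le, Real.exp_log (Real.sqrt_pos.mpr hS.det_ratio_pos)]
  rw [h2]
  exact h1

theorem ricciPotential_symm_eq (h : IsGeneralizedKahler g I J) (hnd : IsNondegenerate g I J)
    {n : ℕ} (hn : Module.finrank ℝ E = 4 * n) (he : e ∈ atlas E M) {y : E} (hy : y ∈ e.target) :
    (ricciPotential g I J ∘ e.symm) y = logDetRatio (endIn I e y) (endIn J e y) := by
  rw [logDetRatio_conj he hy]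
  exact h.ricciPotential_eq hnd hn _

theorem contDiffOn_ricciPotential (h : IsGeneralizedKahler g I J) (hnd : IsNondegenerate g I J)
    {n : ℕ} (hn : Module.finrank ℝ E = 4 * n) (he : e ∈ atlas E M) :
    ContDiffOn ℝ ∞ (ricciPotential g I J ∘ e.symm) e.target :=
  (h.isLocalGenKahler hnd he).contDiffOn_logDetRatio.congr fun _ hy ↦
    h.ricciPotential_symm_eq hnd hn he hy

theorem contMDiff_ricciPotential (h : IsGeneralizedKahler g I J) (hnd : IsNondegenerate g I J)
    {n : ℕ} (hn : Module.finrank ℝ E = 4 * n) :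
    ContMDiff 𝓘(ℝ, E) 𝓘(ℝ, ℝ) ∞ (ricciPotential g I J) := by
  intro x
  have he := chart_mem_atlas E x
  have h1 : ContMDiffOn 𝓘(ℝ, E) 𝓘(ℝ, ℝ) ∞
      ((ricciPotential g I J ∘ (chartAt E x).symm) ∘ chartAt E x)
      (chartAt E x).source :=
    (h.contDiffOn_ricciPotential hnd hn he).contMDiffOn.comp contMDiffOn_chart
      fun z hz ↦ (chartAt E x).map_source hz
  have h2 := h1.congr (f₁ := ricciPotential g I J) fun z hz ↦ by
    simp [(chartAt E x).left_inv hz]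
  exact h2.contMDiffAt ((chartAt E x).open_source.mem_nhds (mem_chart_source E x))

end IsGeneralizedKahler

namespace IsGeneralizedKahler

variable {g : Metric E M} {I J : EndField E M}

theorem ricciIdentity (h : IsGeneralizedKahler g I J) (hnd : IsNondegenerate g I J)
    {n : ℕ} (hn : Module.finrank ℝ E = 4 * n) :
    RicciIdentity g I J (ricciPotential g I J) := by
  intro e he y hy v w
  rw [(h.isLocalGenKahler hnd he).bismutRicci_eq hy]
  have h1 : (fun z ↦ logDetRatio (endIn I e z) (endIn J e z))
      =ᶠ[nhds y] ricciPotential g I J ∘ e.symm := by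
    filter_upwards [e.open_target.mem_nhds hy] with z hz
    exact (h.ricciPotential_symm_eq hnd hn he hz).symm
  rw [dId_congr h1]

theorem ricciIdentity_swap (h : IsGeneralizedKahler g I J) (hnd : IsNondegenerate g I J)
    {n : ℕ} (hn : Module.finrank ℝ E = 4 * n) :
    RicciIdentity g J I (ricciPotential g I J) := by
  intro e he y hy v w
  have h0 := h.isLocalGenKahler hnd he
  rw [h0.swap.bismutRicci_eq hy]
  have h1 : (fun z ↦ logDetRatio (endIn J e z) (endIn I e z))
      =ᶠ[nhds y] ricciPotential g I J ∘ e.symm := by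
    filter_upwards [e.open_target.mem_nhds hy] with z hz
    rw [h.ricciPotential_symm_eq hnd hn he hz, logDetRatio_comm (h0.left.sq z hz)]
  rw [dId_congr h1]

end IsGeneralizedKahler

end FiniteDimensionalCharts

/-! ### The strong maximum principle -/

section MaximumPrinciple

variable {E : Type*} [NormedAddCommGroup E] [NormedSpace ℝ E]

/-- The second order operator `f ↦ D²f(v, v) + D²f(Jv, Jv) - df((D_v J) J v - (D_{Jv} J) v)`, which
is the value of the 2-form `d J d f` on the pair `v, J v`. -/
def leviOperator (J : E → E →L[ℝ] E) (v : E) (f : E → ℝ) (y : E) : ℝ :=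
  fderiv ℝ (fderiv ℝ f) y v v + fderiv ℝ (fderiv ℝ f) y (J y v) (J y v)
    - fderiv ℝ f y (fderiv ℝ J y v (J y v) - fderiv ℝ J y (J y v) v)

theorem differentiableAt_fderiv {f : E → ℝ} {y : E} (hf : ContDiffAt ℝ ∞ f y) :
    DifferentiableAt ℝ (fderiv ℝ f) y :=
  (hf.fderiv_right (m := ∞) (by simp)).differentiableAt (by simp)

theorem eventually_differentiableAt {f : E → ℝ} {y : E} (hf : ContDiffAt ℝ ∞ f y) :
    ∀ᶠ z in nhds y, DifferentiableAt ℝ f z := by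
  filter_upwards [(hf.of_le (m := 1) (by simp)).eventually (by simp)] with z hz
  exact hz.differentiableAt (by simp)

theorem dId_apply_eq_leviOperator {J : E → E →L[ℝ] E} {f : E → ℝ} {y : E}
    (hJ : DifferentiableAt ℝ J y) (hsq : J y * J y = -1) (hf : ContDiffAt ℝ ∞ f y) (v : E) :
    dId J f y ![v, J y v] = leviOperator J v f y := by
  have hf' := differentiableAt_fderiv hf
  have hη : HasFDerivAt (fun z ↦ rotate (J z) (fderiv ℝ f z)) _ y :=
    (hf'.hasFDerivAt.clm_comp hJ.hasFDerivAt).neg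
  have h1 : J y (J y v) = -v := congrArg (fun A : E →L[ℝ] E ↦ A v) hsq
  rw [dId, extDeriv_one_apply hη.differentiableAt, hη.fderiv, leviOperator]
  simp [h1]
  ring

theorem leviOperator_add_smul {J : E → E →L[ℝ] E} {v y : E} {f u : E → ℝ} (c : ℝ)
    (hf : ContDiffAt ℝ ∞ f y) (hu : ContDiffAt ℝ ∞ u y) :
    leviOperator J v (fun z ↦ f z + c * u z) y
      = leviOperator J v f y + c * leviOperator J v u y := by
  have h1 : ∀ z, DifferentiableAt ℝ f z → DifferentiableAt ℝ u z →
      fderiv ℝ (fun z ↦ f z + c * u z) z = fderiv ℝ f z + c • fderiv ℝ u z := fun z h h' ↦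
    (h.hasFDerivAt.add (h'.hasFDerivAt.const_mul c)).fderiv
  have h2 : fderiv ℝ (fun z ↦ f z + c * u z)
      =ᶠ[nhds y] fun z ↦ fderiv ℝ f z + c • fderiv ℝ u z := by
    filter_upwards [eventually_differentiableAt hf, eventually_differentiableAt hu] with z h h'
    exact h1 z h h'
  have h3 : fderiv ℝ (fderiv ℝ (fun z ↦ f z + c * u z)) y
      = fderiv ℝ (fderiv ℝ f) y + c • fderiv ℝ (fderiv ℝ u) y := by
    rw [h2.fderiv_eq]
    exact ((differentiableAt_fderiv hf).hasFDerivAt.add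
      ((differentiableAt_fderiv hu).hasFDerivAt.const_smul c)).fderiv
  rw [leviOperator, h3, h2.eq_of_nhds, leviOperator, leviOperator]
  simp
  ring

/-- The term quadratic in `α` makes `exp (-α s)` a strict subsolution for large `α`, wherever `ds`
does not vanish on `v`. -/
theorem leviOperator_exp {J : E → E →L[ℝ] E} {v y : E} {s : E → ℝ} (α β : ℝ)
    (hs : ContDiffAt ℝ ∞ s y) :
    leviOperator J v (fun z ↦ Real.exp (-α * s z) - β) y
      = Real.exp (-α * s y) * α * (α * ((fderiv ℝ s y v) ^ 2 + (fderiv ℝ s y (J y v)) ^ 2)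
        - leviOperator J v s y) := by
  have h1 : ∀ z, DifferentiableAt ℝ s z → HasFDerivAt (fun z ↦ Real.exp (-α * s z))
      (Real.exp (-α * s z) • (-α • fderiv ℝ s z)) z := fun z h ↦ (h.hasFDerivAt.const_mul (-α)).exp
  have h2 : fderiv ℝ (fun z ↦ Real.exp (-α * s z) - β)
      =ᶠ[nhds y] fun z ↦ Real.exp (-α * s z) • (-α • fderiv ℝ s z) := by
    filter_upwards [eventually_differentiableAt hs] with z h
    exact ((h1 z h).sub_const β).fderiv
  have h3 := (h1 y (hs.differentiableAt (by simp))).smul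
    ((differentiableAt_fderiv hs).hasFDerivAt.const_smul (-α))
  rw [leviOperator, h2.fderiv_eq, h2.eq_of_nhds, leviOperator]
  erw [h3.fderiv]
  simp
  ring

/-- The second derivative test. -/
theorem fderiv_fderiv_nonpos_of_isLocalMax {f : E → ℝ} {y : E} (hf : ContDiffAt ℝ ∞ f y)
    (hmax : IsLocalMax f y) (w : E) : fderiv ℝ (fderiv ℝ f) y w w ≤ 0 := by
  by_contra! hpos
  -- restrict `f` to the line through `y` in direction `w`
  set l : ℝ → E := fun t ↦ y + t • w with hl
  have hl0 : l 0 = y := by simp [hl]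
  have hld : ∀ t, HasDerivAt l w t := fun t ↦ by
    simpa [hl] using ((hasDerivAt_id t).smul_const w).const_add y
  have hlc : Filter.Tendsto l (nhds 0) (nhds y) := by
    have := (hld 0).continuousAt.tendsto; rwa [hl0] at this
  have h1 : deriv (f ∘ l) =ᶠ[nhds 0] fun t ↦ fderiv ℝ f (l t) w := by
    filter_upwards [hlc.eventually (eventually_differentiableAt hf)] with t ht
    exact (ht.hasFDerivAt.comp_hasDerivAt t (hld t)).deriv
  have h2 : deriv (deriv (f ∘ l)) 0 = fderiv ℝ (fderiv ℝ f) y w w := by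
    rw [h1.deriv_eq]
    have h3 : HasFDerivAt (fderiv ℝ f) (fderiv ℝ (fderiv ℝ f) y) (l 0) := by
      rw [hl0]; exact (differentiableAt_fderiv hf).hasFDerivAt
    have h4 := (h3.comp_hasDerivAt 0 (hld 0)).clm_apply (hasDerivAt_const 0 w)
    simpa using h4.deriv
  have hm : IsLocalMax (f ∘ l) 0 := by
    have := hlc.eventually hmax
    filter_upwards [this] with t ht
    simpa [hl0] using ht
  have hc : ContinuousAt (f ∘ l) 0 :=
    ContinuousAt.comp (by rw [hl0]; exact hf.continuousAt) (hld 0).continuousAt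
  have hmin := isLocalMin_of_deriv_deriv_pos (by rw [h2]; exact hpos) hm.deriv_eq_zero hc
  -- a local maximum which is a local minimum has vanishing second derivative
  have h5 : f ∘ l =ᶠ[nhds 0] fun _ ↦ (f ∘ l) 0 := by
    filter_upwards [hm, hmin] with t ht ht'
    exact le_antisymm ht ht'
  have h6 : deriv (deriv (f ∘ l)) 0 = 0 := by
    rw [h5.deriv.deriv_eq]
    simp
  rw [h2] at h6
  exact hpos.ne' h6

theorem leviOperator_nonpos_of_isLocalMax {J : E → E →L[ℝ] E} {f : E → ℝ} {y : E}
    (hf : ContDiffAt ℝ ∞ f y) (hmax : IsLocalMax f y) (v : E) : leviOperator J v f y ≤ 0 := by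
  rw [leviOperator, hmax.fderiv_eq_zero, zero_apply, sub_zero]
  exact add_nonpos (fderiv_fderiv_nonpos_of_isLocalMax hf hmax _)
    (fderiv_fderiv_nonpos_of_isLocalMax hf hmax _)

/-- The strong maximum principle of E. Hopf. At a point `p` of the boundary of the set
`{f < max f}`, at which this set contains a ball with centre `x₁`, the function
`exp (-α |x - x₁|²)` is a strict subsolution for large `α`, in the direction of the radius; a small
multiple of it, added to `f`, produces an interior maximum near `p`, contrary to the second
derivative test. -/
theorem eventually_eq_of_isLocalMax [FiniteDimensional ℝ E] {U : Set E} (hU : IsOpen U)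
    {J : E → E →L[ℝ] E} (hJ : ContDiffOn ℝ ∞ J U) {f : E → ℝ} (hf : ContDiffOn ℝ ∞ f U)
    (hLf : ∀ y ∈ U, ∀ v, leviOperator J v f y = 0) {x₀ : E} (hx₀ : x₀ ∈ U)
    (hmax : IsLocalMax f x₀) : ∀ᶠ x in nhds x₀, f x = f x₀ := by
  have hfU : ∀ x ∈ U, ContDiffAt ℝ ∞ f x := fun x hx ↦ hf.contDiffAt (hU.mem_nhds hx)
  obtain ⟨r, hr, hball⟩ : ∃ r > 0, ∀ x, Euclidean.dist x x₀ ≤ 2 * r → x ∈ U ∧ f x ≤ f x₀ := by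
    obtain ⟨r, hr, h⟩ := Euclidean.nhds_basis_closedBall.mem_iff.mp
      (Filter.inter_mem (hU.mem_nhds hx₀) hmax)
    exact ⟨r / 2, half_pos hr, fun x hx ↦ h (by simpa [Euclidean.closedBall] using (by linarith))⟩
  have hK := Euclidean.isCompact_closedBall (x := x₀) (r := 2 * r)
  have hfK : ContinuousOn f (Euclidean.closedBall x₀ (2 * r)) :=
    hf.continuousOn.mono fun x hx ↦ (hball x hx).1
  filter_upwards [Euclidean.ball_mem_nhds (x := x₀) hr] with a ha
  replace ha : Euclidean.dist a x₀ < r := ha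
  by_contra hne
  -- the nearest point `p` to `a` at which `f` takes its maximum
  set A := Euclidean.closedBall x₀ (2 * r) ∩ f ⁻¹' {f x₀} with hA
  have hAc : IsCompact A := hK.of_isClosed_subset
    (hfK.preimage_isClosed_of_isClosed hK.isClosed isClosed_singleton) Set.inter_subset_left
  have hx₀A : x₀ ∈ A := ⟨by simp [Euclidean.closedBall, Euclidean.dist, hr.le], rfl⟩
  obtain ⟨p, ⟨hpK, hpf⟩, hpmin⟩ := hAc.exists_isMinOn (f := fun x ↦ Euclidean.dist x a) ⟨x₀, hx₀A⟩
    (by unfold Euclidean.dist; fun_prop)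
  replace hpf : f p = f x₀ := hpf
  have hpa : Euclidean.dist p a < r :=
    (hpmin hx₀A).trans_lt (by
      change dist (toEuclidean x₀) (toEuclidean a) < r
      rw [dist_comm]; exact ha)
  have hpx : Euclidean.dist p x₀ < 2 * r :=
    (dist_triangle _ (toEuclidean a) _).trans_lt (by
      unfold Euclidean.dist at hpa ha; linarith)
  have hpU : p ∈ U := (hball p hpx.le).1
  set x₁ : E := (1 / 2 : ℝ) • (p + a) with hx₁
  set v : E := p - x₁ with hv
  have hv' : v = x₁ - a := by
    have : p + a = x₁ + x₁ := by rw [hx₁, ← add_smul]; norm_num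
    rw [hv, sub_eq_sub_iff_add_eq_add, this]
  have hv0 : v ≠ 0 := fun h0 ↦ by
    have h1 : p = a := by
      rw [h0] at hv hv'
      rw [sub_eq_zero.mp hv.symm, sub_eq_zero.mp hv'.symm]
    exact hne (h1 ▸ hpf)
  set s : E → ℝ := fun x ↦ ‖toEuclidean (x - x₁)‖ ^ 2 with hs
  have hsp : s p = ‖toEuclidean v‖ ^ 2 := rfl
  have hsC : ContDiff ℝ ∞ s :=
    (toEuclidean.contDiff.comp (contDiff_id.sub contDiff_const)).norm_sq ℝ
  -- the closed ball with centre `x₁` through `p` touches the set `A` only at `p`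
  have htouch : ∀ x, Euclidean.dist x x₀ ≤ 2 * r → s x ≤ s p → x ≠ p → f x < f x₀ := by
    intro x hx hsx hxp
    refine lt_of_le_of_ne (hball x hx).2 fun hfx ↦ ?_
    have h1 : Euclidean.dist p a ≤ Euclidean.dist x a := hpmin ⟨hx, hfx⟩
    have h2 := parallelogram_law_with_norm ℝ (toEuclidean (x - x₁)) (toEuclidean v)
    have e1 : x - x₁ + v = x - a := by rw [hv']; abel
    have e2 : x - x₁ - v = x - p := by rw [hv]; abel
    have e3 : p - a = (2 : ℝ) • v := by
      have : p - a = v + v := by nth_rw 1 [hv]; rw [hv']; abel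
      rw [this, two_smul]
    rw [← map_add, ← map_sub, e1, e2] at h2
    have h3 : 0 < ‖toEuclidean (x - p)‖ :=
      norm_pos_iff.mpr ((map_ne_zero_iff _ toEuclidean.injective).mpr (sub_ne_zero.mpr hxp))
    replace h1 : ‖toEuclidean (p - a)‖ ≤ ‖toEuclidean (x - a)‖ := by
      simpa only [Euclidean.dist, dist_eq_norm, map_sub] using h1
    rw [e3, map_smul, norm_smul, Real.norm_ofNat] at h1
    have h4 : ‖toEuclidean (x - x₁)‖ ^ 2 ≤ ‖toEuclidean v‖ ^ 2 := hsx
    nlinarith [norm_nonneg (toEuclidean v), norm_nonneg (toEuclidean (x - a))]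
  have hdsp : 0 < fderiv ℝ s p v := by
    have h1 : HasFDerivAt (fun x ↦ toEuclidean (x - x₁))
        (toEuclidean (E := E)).toContinuousLinearMap p :=
      (toEuclidean (E := E)).toContinuousLinearMap.hasFDerivAt.comp p
        ((hasFDerivAt_id p).sub_const x₁)
    have h2 := h1.norm_sq
    rw [h2.fderiv]
    have h3 : 0 < ‖toEuclidean v‖ :=
      norm_pos_iff.mpr ((map_ne_zero_iff _ toEuclidean.injective).mpr hv0)
    change 0 < 2 • inner ℝ (toEuclidean v) (toEuclidean v)
    rw [real_inner_self_eq_norm_sq]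
    positivity
  -- the barrier is a strict subsolution near `p`
  have hJp := hJ.contDiffAt (hU.mem_nhds hpU)
  obtain ⟨α, hα, hsub⟩ : ∃ α > 0, ∀ᶠ x in nhds p,
      0 < α * ((fderiv ℝ s x v) ^ 2 + (fderiv ℝ s x (J x v)) ^ 2) - leviOperator J v s x := by
    have hds : ContinuousAt (fderiv ℝ s) p := (hsC.continuous_fderiv (by simp)).continuousAt
    have hdds : ContinuousAt (fderiv ℝ (fderiv ℝ s)) p :=
      ((hsC.fderiv_right (m := ∞) (by simp)).continuous_fderiv (by simp)).continuousAt
    have hJc := hJp.continuousAt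
    have hdJ : ContinuousAt (fderiv ℝ J) p :=
      (hJp.fderiv_right (m := ∞) (by simp)).continuousAt
    have h1 : ContinuousAt (fun x ↦ (fderiv ℝ s x v) ^ 2) p := by fun_prop
    have h2 : ContinuousAt (fun x ↦ leviOperator J v s x) p := by unfold leviOperator; fun_prop
    set c := (fderiv ℝ s p v) ^ 2 / 2 with hc
    have hc0 : 0 < c := by positivity
    set b := |leviOperator J v s p| + 1 with hb
    have hb0 : 0 < b := by positivity
    refine ⟨b / c, by positivity, ?_⟩
    filter_upwards [h1.eventually_const_lt (u := c) (by rw [hc]; linarith [sq_pos_of_pos hdsp]),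
      h2.eventually_lt_const (u := b) (by rw [hb]; linarith [le_abs_self (leviOperator J v s p)])]
      with x hx1 hx2
    have h3 : b / c * c = b := by field_simp
    nlinarith [sq_nonneg (fderiv ℝ s x (J x v)), div_pos hb0 hc0]
  obtain ⟨δ, hδ, hD⟩ := Euclidean.nhds_basis_closedBall.mem_iff.mp
    (Filter.inter_mem hsub (Euclidean.isOpen_ball (x := x₀) (r := 2 * r) |>.mem_nhds hpx))
  have hDx : ∀ x, Euclidean.dist x p ≤ δ → Euclidean.dist x x₀ ≤ 2 * r := fun x hx ↦
    le_of_lt (hD hx).2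
  set ψ : E → ℝ := fun x ↦ Real.exp (-α * s x) - Real.exp (-α * s p) with hψ
  have hψC : ContDiff ℝ ∞ ψ := (contDiff_const.mul hsC).exp.sub contDiff_const
  have hψle : ∀ x, ψ x ≤ 1 := fun x ↦ by
    have h1 : Real.exp (-α * s x) ≤ 1 := Real.exp_le_one_iff.mpr (by
      have : 0 ≤ s x := sq_nonneg _
      nlinarith)
    have h2 := Real.exp_pos (-α * s p)
    simp only [hψ]; linarith
  have hDc := Euclidean.isCompact_closedBall (x := p) (r := δ)
  have hfD : ContinuousOn f (Euclidean.closedBall p δ) := hfK.mono fun x hx ↦ hDx x hx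
  have hdist : Continuous fun x ↦ Euclidean.dist x p := by unfold Euclidean.dist; fun_prop
  -- on the part of the small sphere where the barrier is nonnegative, `f` is below its maximum
  obtain ⟨m, hm, hmle⟩ : ∃ m, f x₀ > m ∧
      ∀ x ∈ Euclidean.closedBall p δ ∩ {x | Euclidean.dist x p = δ ∧ 0 ≤ ψ x}, f x ≤ m := by
    have hc : IsCompact (Euclidean.closedBall p δ ∩ {x | Euclidean.dist x p = δ ∧ 0 ≤ ψ x}) :=
      hDc.inter_right ((isClosed_eq hdist continuous_const).inter
        (isClosed_le continuous_const hψC.continuous))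
    suffices hlt : ∀ x ∈ Euclidean.closedBall p δ ∩ {x | Euclidean.dist x p = δ ∧ 0 ≤ ψ x},
        f x < f x₀ by
      obtain ⟨m, hm, hm'⟩ := hc.exists_forall_le' (a := -f x₀)
        (hfD.mono Set.inter_subset_left).neg (fun x hx ↦ neg_lt_neg (hlt x hx))
      exact ⟨-m, neg_lt.mp hm, fun x hx ↦ le_neg.mp (hm' x hx)⟩
    intro x hx
    refine htouch x (hDx x hx.1) ?_ fun h ↦ ?_
    · have h1 : Real.exp (-α * s p) ≤ Real.exp (-α * s x) := sub_nonneg.mp hx.2.2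
      have h2 := Real.exp_le_exp.mp h1
      nlinarith
    · have h3 := hx.2.1
      rw [h] at h3
      simp [Euclidean.dist] at h3
      exact hδ.ne h3
  -- small enough not to lift `f + ε ψ` to `max f` on the small sphere, as `ψ ≤ 1`
  set ε := (f x₀ - m) / 2 with hε
  have hε0 : 0 < ε := by rw [hε]; linarith
  set h : E → ℝ := fun x ↦ f x + ε * ψ x with hh
  have hhp : h p = f x₀ := by simp [hh, hψ, hpf]
  have hbd : ∀ x, Euclidean.dist x p = δ → h x < f x₀ := by
    intro x hx
    have hfx := (hball x (hDx x hx.le)).2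
    rcases le_or_gt 0 (ψ x) with h0 | h0
    · have h1 := hmle x ⟨hx.le, hx, h0⟩
      have h2 := hψle x
      simp only [hh]
      nlinarith
    · simp only [hh]
      nlinarith
  obtain ⟨q, hqD, hqmax⟩ := hDc.exists_isMaxOn (f := h) ⟨p, by
    simp [Euclidean.closedBall, Euclidean.dist, hδ.le]⟩
    (hfD.add (continuous_const.mul hψC.continuous).continuousOn)
  have hqp : f x₀ ≤ h q := hhp ▸ hqmax (by simp [Euclidean.closedBall, Euclidean.dist, hδ.le])
  have hqlt : Euclidean.dist q p < δ :=
    lt_of_le_of_ne hqD fun heq ↦ absurd (hbd q heq) (not_lt.mpr hqp)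
  have hqU : q ∈ U := (hball q (hDx q hqD)).1
  have hqloc : IsLocalMax h q := by
    filter_upwards [(isOpen_lt hdist continuous_const).mem_nhds hqlt] with x hx
    exact hqmax (le_of_lt hx : Euclidean.dist x p ≤ δ)
  have hq1 := leviOperator_nonpos_of_isLocalMax (J := J)
    ((hfU q hqU).add (contDiffAt_const.mul hψC.contDiffAt)) hqloc v
  have hq2 := leviOperator_add_smul (J := J) (v := v) ε (hfU q hqU) hψC.contDiffAt
  rw [hLf q hqU, leviOperator_exp α _ hsC.contDiffAt, zero_add] at hq2
  have hq3 : 0 < ε * (Real.exp (-α * s q) * α * (α * ((fderiv ℝ s q v) ^ 2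
      + (fderiv ℝ s q (J q v)) ^ 2) - leviOperator J v s q)) :=
    mul_pos hε0 (mul_pos (mul_pos (Real.exp_pos _) hα) (hD hqD).1)
  exact absurd (hq2 ▸ hq1) (not_le.mpr hq3)

end MaximumPrinciple

/-! ### Compact manifolds -/

section CompactCase

theorem dId_of_const {E : Type*} [NormedAddCommGroup E] [NormedSpace ℝ E] (J : E → E →L[ℝ] E)
    (c : ℝ) (y : E) : dId J (fun _ ↦ c) y = 0 := by
  have h : (fun z : E ↦ ContinuousAlternatingMap.ofSubsingletonLIE (𝕜 := ℝ) (E := E) (F := ℝ)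
      (0 : Fin 1) (rotate (J z) (fderiv ℝ (fun _ : E ↦ c) z))) = fun _ ↦ 0 := by
    funext z
    have h1 : rotate (J z) (fderiv ℝ (fun _ : E ↦ c) z) = 0 := by simp [rotate]
    rw [h1, map_zero]
  rw [dId, h, extDeriv, fderiv_const_apply]
  exact map_zero (ContinuousAlternatingMap.alternatizeUncurryFinCLM ℝ E ℝ)

variable {E : Type*} [NormedAddCommGroup E] [NormedSpace ℝ E] [FiniteDimensional ℝ E]
  {M : Type*} [TopologicalSpace M] [ChartedSpace E M] [IsManifold 𝓘(ℝ, E) ∞ M]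
  {g : Metric E M} {I J : EndField E M}

/-- On a compact connected manifold a solution of `d J d f = 0` is constant: the set where it takes
its maximum is closed, and is open by the strong maximum principle. -/
theorem IsHermitian.exists_eq_const_of_dId_eq_zero [CompactSpace M] [ConnectedSpace M]
    (hJ : IsHermitian g J) {f : M → ℝ} (hf : ContMDiff 𝓘(ℝ, E) 𝓘(ℝ, ℝ) ∞ f)
    (h : ∀ e ∈ atlas E M, ∀ y ∈ e.target, ∀ v w : E,
      dId (endIn J e) (f ∘ e.symm) y ![v, w] = 0) : ∃ c : ℝ, ∀ x : M, f x = c := by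
  obtain ⟨x₀, -, hx₀⟩ := isCompact_univ.exists_isMaxOn Set.univ_nonempty
    hf.continuous.continuousOn
  have hmax : ∀ x, f x ≤ f x₀ := fun x ↦ hx₀ (Set.mem_univ x)
  have hopen : IsOpen {x | f x = f x₀} := by
    refine isOpen_iff_mem_nhds.mpr fun x (hx : f x = f x₀) ↦ ?_
    set e := chartAt E x
    have he : e ∈ atlas E M := chart_mem_atlas E x
    have hxs : x ∈ e.source := mem_chart_source E x
    have hL := hJ.isLocalHermitian he
    have hfe : ContDiffOn ℝ ∞ (f ∘ e.symm) e.target :=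
      (hf.comp_contMDiffOn (contMDiffOn_symm_of_mem_maximalAtlas (I := 𝓘(ℝ, E)) (n := ∞)
        (StructureGroupoid.subset_maximalAtlas _ he))).contDiffOn
    have h1 := eventually_eq_of_isLocalMax e.open_target hL.smooth hfe
      (fun y hy v ↦ by
        rw [← dId_apply_eq_leviOperator ((hL.contDiffAt hy).differentiableAt (by simp))
          (hL.sq y hy) (hfe.contDiffAt (e.open_target.mem_nhds hy))]
        exact h e he y hy _ _) (e.map_source hxs) (by
        refine Filter.Eventually.of_forall fun y ↦ ?_
        simpa [e.left_inv hxs, hx] using hmax (e.symm y))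
    filter_upwards [(e.continuousAt hxs).eventually h1, e.open_source.mem_nhds hxs] with z hz hzs
    simpa [e.left_inv hxs, e.left_inv hzs, hx] using hz
  have hclopen : IsClopen {x | f x = f x₀} := ⟨isClosed_eq hf.continuous continuous_const, hopen⟩
  have huniv := hclopen.eq_univ ⟨x₀, rfl⟩
  exact ⟨f x₀, fun x ↦ (huniv ▸ Set.mem_univ x : x ∈ {x | f x = f x₀})⟩

theorem RicciIdentity.bismutRicciFlat_iff [CompactSpace M] [ConnectedSpace M]
    (hJ : IsHermitian g J) {f : M → ℝ} (hf : ContMDiff 𝓘(ℝ, E) 𝓘(ℝ, ℝ) ∞ f)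
    (h : RicciIdentity g I J f) : BismutRicciFlat g I ↔ ∃ c : ℝ, ∀ x : M, f x = c := by
  constructor
  · intro hI
    refine hJ.exists_eq_const_of_dId_eq_zero hf fun e he y hy v w ↦ ?_
    have h1 := h e he y hy v w
    rw [hI e he y hy v w] at h1
    linarith
  · rintro ⟨c, hc⟩ e he y hy v w
    have h1 : f ∘ e.symm = fun _ ↦ c := funext fun z ↦ hc _
    rw [h e he y hy v w, h1, dId_of_const]
    simp

end CompactCase

end GenKahler

end

theorem mainTheorem7
    {E : Type*} [NormedAddCommGroup E] [NormedSpace ℝ E] [FiniteDimensional ℝ E]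
    {M : Type*} [TopologicalSpace M] [T2Space M] [SecondCountableTopology M]
    [ChartedSpace E M] [IsManifold 𝓘(ℝ, E) ∞ M]
    (n : ℕ) (hn : Module.finrank ℝ E = 4 * n)
    (g : GenKahler.Metric E M) (I J : GenKahler.EndField E M)
    (hGK : GenKahler.IsGeneralizedKahler g I J)
    (hnd : GenKahler.IsNondegenerate g I J) :
    -- the Ricci potential is a well-defined smooth function
    (∀ x : M, GenKahler.pairingMinusAt g I J x ≠ 0 ∧
      GenKahler.pairingPlusAt g I J x
        = ((Real.exp (GenKahler.ricciPotential g I J x) : ℝ) : ℂ) •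
          GenKahler.pairingMinusAt g I J x) ∧
    ContMDiff 𝓘(ℝ, E) 𝓘(ℝ, ℝ) ∞ (GenKahler.ricciPotential g I J) ∧
    -- the two curvature identities
    GenKahler.RicciIdentity g I J (GenKahler.ricciPotential g I J) ∧
    GenKahler.RicciIdentity g J I (GenKahler.ricciPotential g I J) ∧
    -- the compact case
    (CompactSpace M → ConnectedSpace M →
      (GenKahler.BismutRicciFlat g I ↔ GenKahler.BismutRicciFlat g J) ∧
      (GenKahler.BismutRicciFlat g J ↔
        ∃ c : ℝ, ∀ x : M, GenKahler.ricciPotential g I J x = c)) := by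
  have hsmooth := hGK.contMDiff_ricciPotential hnd hn
  have hI := hGK.ricciIdentity hnd hn
  have hJ := hGK.ricciIdentity_swap hnd hn
  refine ⟨hGK.pairing_ne_zero_and_eq hnd hn, hsmooth, hI, hJ, fun _ _ ↦ ?_⟩
  have hI' := hI.bismutRicciFlat_iff hGK.hermitian_right hsmooth
  have hJ' := hJ.bismutRicciFlat_iff hGK.hermitian_left hsmooth
  exact ⟨hI'.trans hJ'.symm, hJ'⟩
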